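/- Consider the word RAM with word size $w$: registers and memory cells hold $w$-bit words, memory is addressed by words, and each executed instruction (loading a constant, copying a register, addition, subtraction, multiplication modulo $2^w$, bitwise Boolean operations, shifts, memory load and store, jumps, comparisons) costs one step. There are a fixed program $P$ and constants $T$ and $C$ such that the following holds for all $n$ and all word sizes $w$ with $n<2^w$ (so that the numbers $1,\dots,n$ fit into a word), for every $n$-element set and every partition of it into equivalence classes. The elements can be given distinct labels from $\{1,\dots,n\}$, chosen depending on the partition, and the partition can be represented by a string of at most $C\sqrt n\,\lg n$ bits (where $\lg=\log_2$), stored in memory packed consecutively into $w$-bit words, such that, given the labels of any two elements, $P$ decides in at most $T$ steps whether the two elements are in the same equivalence class. In short: a partition of an $n$-element set can be represented using $O(\sqrt n\lg n)$ bits such that equivalence queries are answered in constant time. -/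

import Mathlib

/-! A word RAM with word size `w`: finitely many instructions, registers and memory cells holding
`w`-bit words, memory addressed by words.  Every executed instruction costs one step. -/

namespace WordRAM

/-- The binary word operations, all computed on `w`-bit words (arithmetic is modulo `2 ^ w`).
There is no division and no square root. -/
inductive BinOp where
  | add
  | sub
  | mul
  | and
  | or
  | xor
  | shl
  | shr

/-- The value of a binary operation; shifts are logical, by the value of the second operand. -/
def BinOp.eval {w : ℕ} : BinOp → BitVec w → BitVec w → BitVec w
  | .add, a, b => a + b
  | .sub, a, b => a - b
  | .mul, a, b => a * b
  | .and, a, b => a &&& b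
  | .or, a, b => a ||| b
  | .xor, a, b => a ^^^ b
  | .shl, a, b => a <<< b
  | .shr, a, b => a >>> b

/-- Instructions. Registers are numbered by natural numbers; since a program is a finite list,
it uses only finitely many of them. Jump targets are positions in the program. -/
inductive Instr where
  /-- `reg dst := k` (modulo `2 ^ w`) -/
  | const (dst : ℕ) (k : ℕ)
  /-- `reg dst := reg a` -/
  | move (dst a : ℕ)
  /-- `reg dst := op (reg a) (reg b)` -/
  | bin (op : BinOp) (dst a b : ℕ)
  /-- `reg dst := bitwise complement of reg a` -/
  | not (dst a : ℕ)
  /-- `reg dst := mem (reg a)` -/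
  | load (dst a : ℕ)
  /-- `mem (reg a) := reg b` -/
  | store (a b : ℕ)
  /-- unconditional jump -/
  | jump (target : ℕ)
  /-- jump if `reg a = reg b` -/
  | jumpEq (a b target : ℕ)
  /-- jump if `reg a < reg b` as unsigned numbers -/
  | jumpLt (a b target : ℕ)

/-- A program does not mention the word size: the same program runs for every `w`. -/
abbrev Program := List Instr

/-- A configuration of the machine with word size `w`. -/
structure Config (w : ℕ) where
  /-- program counter -/
  pc : ℕ
  /-- registers -/
  reg : ℕ → BitVec w
  /-- memory, consisting of `2 ^ w` words -/
  mem : BitVec w → BitVec w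

/-- Write `v` into register `dst` and go to the next instruction. -/
def Config.setReg {w : ℕ} (c : Config w) (dst : ℕ) (v : BitVec w) : Config w :=
  { c with pc := c.pc + 1, reg := Function.update c.reg dst v }

/-- Jump to `target` if the condition `b` holds, otherwise go to the next instruction. -/
def Config.branch {w : ℕ} (c : Config w) (b : Bool) (target : ℕ) : Config w :=
  { c with pc := if b then target else c.pc + 1 }

/-- The effect of one instruction. -/
def Instr.exec {w : ℕ} (c : Config w) : Instr → Config w
  | .const dst k => c.setReg dst (BitVec.ofNat w k)
  | .move dst a => c.setReg dst (c.reg a)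
  | .bin op dst a b => c.setReg dst (op.eval (c.reg a) (c.reg b))
  | .not dst a => c.setReg dst (~~~ (c.reg a))
  | .load dst a => c.setReg dst (c.mem (c.reg a))
  | .store a b => { c with pc := c.pc + 1, mem := Function.update c.mem (c.reg a) (c.reg b) }
  | .jump target => c.branch true target
  | .jumpEq a b target => c.branch (decide (c.reg a = c.reg b)) target
  | .jumpLt a b target => c.branch (decide ((c.reg a).toNat < (c.reg b).toNat)) target

/-- The machine has halted when the program counter has left the program. -/
def Halted (P : Program) {w : ℕ} (c : Config w) : Prop := P[c.pc]? = none

/-- One step of the machine; a halted machine does not change. -/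
def step (P : Program) {w : ℕ} (c : Config w) : Config w :=
  match P[c.pc]? with
  | some i => i.exec c
  | none => c

/-- The memory image of a bit string `d` of length `L`, packed without gaps into `w`-bit words:
the word at address `a` consists of the bits `a * w, …, a * w + w - 1` of `d`; bits from
position `L` on are zero. -/
def memImage {L : ℕ} (d : BitVec L) (w : ℕ) : BitVec w → BitVec w :=
  fun a => d.extractLsb' (a.toNat * w) w

/-- The initial configuration of a query `(x, y)` to the data structure `d`: memory holds `d`,
registers `0` and `1` hold `x` and `y`, all other registers are zero. -/
def initConfig {L : ℕ} (d : BitVec L) {w : ℕ} (x y : BitVec w) : Config w where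
  pc := 0
  reg := fun i => if i = 0 then x else if i = 1 then y else 0
  mem := memImage d w

/-- Started in `c`, the program `P` halts after at most `T` steps with `out` in register `0`. -/
def ReturnsWithin (P : Program) (T : ℕ) {w : ℕ} (c : Config w) (out : BitVec w) : Prop :=
  ∃ t ≤ T, Halted P ((step P)^[t] c) ∧ ((step P)^[t] c).reg 0 = out

/-- With the data structure `d` on the machine of word size `w`, and with the elements of `α`
named by `label`, the program `P` answers every equivalence query for `r` within `T` steps
(answer `1` for equivalent, `0` for not equivalent). -/
def AnswersEquivQueries (P : Program) (T w : ℕ) {L : ℕ} (d : BitVec L) {α : Type*}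
    (r : Setoid α) (label : α → ℕ) : Prop :=
  ∀ x y : α,
    (r x y → ReturnsWithin P T
      (initConfig d (BitVec.ofNat w (label x)) (BitVec.ofNat w (label y))) 1) ∧
    (¬ r x y → ReturnsWithin P T
      (initConfig d (BitVec.ofNat w (label x)) (BitVec.ofNat w (label y))) 0)

end WordRAM

/-! The distinct sizes of the classes sum to at most n, so there are only O(√n) of them
(`card_le_of_sum_le`). An element is located by the size s of its class and an index u among all
elements lying in classes of size s. If every class occupies consecutive indices, the pair (s, u /
s) determines the class (`exists_class_coordinates`). It remains to recover this pair from a label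
with O(√n) stored numbers and without a division instruction.

Labels are dealt cyclically to K = 2^k bins with K² ≥ 8n, so bin and position are bit fields of the
label minus one. The alias method (`exists_alias_distribution`) fills each bin with pieces of at
most two sizes; the bin stores one threshold and a short description of each piece. Positions have
about half as many bits as n, so within a piece the quotient u / s can be computed by one product
that fits into a word and one shift (`exists_reciprocal`).

One program must serve all n and w, and w may be far larger than lg n. Hence the numbers are packed
densely into fields, and a header read from the first word reveals the packing (`Layout`). Words of
at most 31 bits leave only boundedly many elements, and a plain table suffices. The query is a
loop-free expression, so its code length bounds the running time. -/

namespace WordRAM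

/-! ### Loop-free expressions and their compilation -/

/-- Side-effect free expressions over the two query words and the memory. -/
inductive Expr where
  | x
  | y
  | const (k : ℕ)
  | bin (op : BinOp) (a b : Expr)
  | load (a : Expr)
  | eq (a b : Expr)
  | lt (a b : Expr)

namespace Expr

/-- The value of an expression; comparisons have value `0` or `1`. -/
def eval {w : ℕ} (x y : BitVec w) (mem : BitVec w → BitVec w) : Expr → BitVec w
  | .x => x
  | .y => y
  | .const k => BitVec.ofNat w k
  | .bin op a b => op.eval (a.eval x y mem) (b.eval x y mem)
  | .load a => mem (a.eval x y mem)
  | .eq a b => if a.eval x y mem = b.eval x y mem then BitVec.ofNat w 1 else BitVec.ofNat w 0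
  | .lt a b =>
      if (a.eval x y mem).toNat < (b.eval x y mem).toNat then BitVec.ofNat w 1
      else BitVec.ofNat w 0

/-- Code computing an expression into register `d`, placed at position `base`; it uses the
registers from `d` on as a stack. -/
def compile : Expr → ℕ → ℕ → Program
  | .x, _, d => [.move d 0]
  | .y, _, d => [.move d 1]
  | .const k, _, d => [.const d k]
  | .bin op a b, base, d =>
      let ca := a.compile base d
      ca ++ (b.compile (base + ca.length) (d + 1) ++ [.bin op d d (d + 1)])
  | .load a, base, d => a.compile base d ++ [.load d d]
  | .eq a b, base, d =>
      let ca := a.compile base d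
      let cb := b.compile (base + ca.length) (d + 1)
      let pos := base + ca.length + cb.length
      ca ++ (cb ++ [.jumpEq d (d + 1) (pos + 3), .const d 0, .jump (pos + 4), .const d 1])
  | .lt a b, base, d =>
      let ca := a.compile base d
      let cb := b.compile (base + ca.length) (d + 1)
      let pos := base + ca.length + cb.length
      ca ++ (cb ++ [.jumpLt d (d + 1) (pos + 3), .const d 0, .jump (pos + 4), .const d 1])

end Expr

/-- The program `P` contains `code` at position `pos`. -/
def CodeAt (P : Program) (pos : ℕ) (code : Program) : Prop :=
  ∀ i < code.length, P[pos + i]? = code[i]?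

theorem CodeAt.left {P : Program} {pos : ℕ} {a b : Program} (h : CodeAt P pos (a ++ b)) :
    CodeAt P pos a := by
  intro i hi
  rw [h i (by simp; omega), List.getElem?_append_left hi]

theorem CodeAt.right {P : Program} {pos : ℕ} {a b : Program} (h : CodeAt P pos (a ++ b)) :
    CodeAt P (pos + a.length) b := by
  intro i hi
  rw [add_assoc, h (a.length + i) (by simp; omega),
    List.getElem?_append_right (by omega)]
  simp

theorem step_of_getElem? {P : Program} {w : ℕ} {c : Config w} {i : Instr} {pos : ℕ}
    (hpc : c.pc = pos) (h : P[pos]? = some i) : step P c = i.exec c := by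
  subst hpc
  unfold step
  rw [h]

/-- `c'` arises from `c` by running a piece of code at `base` of length `len` that computes `v`
into register `d`. -/
def Computes (P : Program) {w : ℕ} (c : Config w) (base len d : ℕ) (v : BitVec w) : Prop :=
  ∃ t ≤ len, ((step P)^[t] c).pc = base + len ∧ ((step P)^[t] c).reg d = v ∧
    (∀ i < d, ((step P)^[t] c).reg i = c.reg i) ∧ ((step P)^[t] c).mem = c.mem

theorem computes_of_step {P : Program} {w : ℕ} {c : Config w} {base d : ℕ} {v : BitVec w}
    {i : Instr} (hpc : c.pc = base) (h : CodeAt P base [i]) (he : i.exec c = c.setReg d v) :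
    Computes P c base 1 d v := by
  have h0 := h 0 (by simp)
  refine ⟨1, le_rfl, ?_⟩
  rw [Function.iterate_one, step_of_getElem? hpc (by simpa using h0), he]
  refine ⟨by simp [Config.setReg, hpc], by simp [Config.setReg], ?_, rfl⟩
  intro j hj
  simp [Config.setReg, Function.update, hj.ne]

/-- Sequential composition of two computations. -/
theorem Computes.trans {P : Program} {w : ℕ} {c : Config w} {base len len' d d' : ℕ}
    {v v' : BitVec w} (h : Computes P c base len d v) (hd : d' ≤ d + 1)
    (h' : ∀ c' : Config w, c'.pc = base + len → c'.reg d = v → (∀ i < d, c'.reg i = c.reg i) →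
      c'.mem = c.mem → Computes P c' (base + len) len' d' v') :
    ∃ t ≤ len + len', ((step P)^[t] c).pc = base + (len + len') ∧
      ((step P)^[t] c).reg d' = v' ∧
      (∀ i < d', i < d → ((step P)^[t] c).reg i = c.reg i) ∧
      (∀ i < d', i = d → ((step P)^[t] c).reg i = v) ∧ ((step P)^[t] c).mem = c.mem := by
  obtain ⟨t, ht, h1, h2, h3, h4⟩ := h
  obtain ⟨t', ht', h1', h2', h3', h4'⟩ := h' _ h1 h2 h3 h4
  refine ⟨t' + t, by omega, ?_⟩
  rw [Function.iterate_add_apply]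
  refine ⟨by omega, h2', fun i hi hid => (h3' i hi).trans (h3 i hid), ?_, h4'.trans h4⟩
  intro i hi hid
  subst hid
  rw [h3' i hi, h2]

theorem Computes.trans_of_le {P : Program} {w : ℕ} {c : Config w} {base len len' d : ℕ}
    {v v' : BitVec w} (h : Computes P c base len d v)
    (h' : ∀ c' : Config w, c'.pc = base + len → c'.reg d = v → (∀ i < d, c'.reg i = c.reg i) →
      c'.mem = c.mem → Computes P c' (base + len) len' d v') :
    Computes P c base (len + len') d v' := by
  obtain ⟨t, ht, h1, h2, h3, -, h4⟩ := h.trans (by omega) h'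
  exact ⟨t, ht, h1, h2, fun i hi => h3 i hi hi, h4⟩

/-- Two operands are computed into registers `d` and `d + 1` and then combined. -/
theorem Computes.trans_operands {P : Program} {w : ℕ} {c : Config w} {base la lb lc d : ℕ}
    {va vb v : BitVec w} (ha : Computes P c base la d va)
    (hb : ∀ c' : Config w, c'.pc = base + la → (∀ i < d, c'.reg i = c.reg i) →
      c'.mem = c.mem → Computes P c' (base + la) lb (d + 1) vb)
    (hc : ∀ c' : Config w, c'.pc = base + la + lb → c'.reg d = va → c'.reg (d + 1) = vb →
      Computes P c' (base + la + lb) lc d v) :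
    Computes P c base (la + (lb + lc)) d v := by
  obtain ⟨t, ht, h1, h2, h3, h3', h4⟩ :=
    ha.trans (d' := d + 1) le_rfl fun c' e1 _ e3 e4 => hb c' e1 e3 e4
  obtain ⟨t', ht', h1', h2', h3'', h4'⟩ :=
    hc _ (h1.trans (by omega)) (h3' d (by omega) rfl) h2
  refine ⟨t' + t, by omega, ?_⟩
  rw [Function.iterate_add_apply]
  exact ⟨by omega, h2', fun i hi => (h3'' i hi).trans (h3 i (by omega) hi), h4'.trans h4⟩

/-- Both paths run forward through the four instructions: a false test takes three steps (jump not
taken, write 0, skip), a true one takes two. -/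
theorem computes_branch {P : Program} {w : ℕ} {c : Config w} {pos d : ℕ} {jmp : Instr}
    (b : Bool) (hpc : c.pc = pos) (hj : jmp.exec c = c.branch b (pos + 3))
    (h : CodeAt P pos [jmp, .const d 0, .jump (pos + 4), .const d 1]) :
    Computes P c pos 4 d (if b then BitVec.ofNat w 1 else BitVec.ofNat w 0) := by
  have h0 : P[pos]? = some jmp := by simpa using h 0 (by simp)
  have h1 : P[pos + 1]? = some (.const d 0) := by simpa using h 1 (by simp)
  have h2 : P[pos + 2]? = some (.jump (pos + 4)) := by simpa using h 2 (by simp)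
  have h3 : P[pos + 3]? = some (.const d 1) := by simpa using h 3 (by simp)
  cases b
  · have e : (step P)^[3] c = ((c.branch false (pos + 3)).setReg d (BitVec.ofNat w 0)).branch
        true (pos + 4) := by
      have s2 : step P (c.branch false (pos + 3)) = _ :=
        step_of_getElem? (pos := pos + 1) (by simp [Config.branch, hpc]) h1
      have s3 : step P ((c.branch false (pos + 3)).setReg d (BitVec.ofNat w 0)) = _ :=
        step_of_getElem? (pos := pos + 2) (by simp [Config.setReg, Config.branch, hpc]) h2
      simp only [Function.iterate_succ, Function.iterate_zero, Function.comp, id]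
      rw [step_of_getElem? hpc h0, hj, s2, Instr.exec, s3, Instr.exec]
    refine ⟨3, by omega, ?_⟩
    rw [e]
    refine ⟨by simp [Config.branch], by simp [Config.branch, Config.setReg], ?_, rfl⟩
    intro i hi
    simp [Config.branch, Config.setReg, Function.update, hi.ne]
  · have e : (step P)^[2] c = (c.branch true (pos + 3)).setReg d (BitVec.ofNat w 1) := by
      simp only [Function.iterate_succ, Function.iterate_zero, Function.comp, id]
      rw [step_of_getElem? hpc h0, hj,
        step_of_getElem? (pos := pos + 3) (by simp [Config.branch]) h3, Instr.exec]
    refine ⟨2, by omega, ?_⟩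
    rw [e]
    refine ⟨by simp [Config.branch, Config.setReg],
      by simp [Config.branch, Config.setReg], ?_, rfl⟩
    intro i hi
    simp [Config.branch, Config.setReg, Function.update, hi.ne]

/-- Structural induction. Requiring `2 ≤ d` protects the query words in registers 0 and 1, and the
second operand is computed from `d + 1` on, so the first one survives. No code stores to memory or
jumps backwards, hence the length bounds the number of steps for every word size. -/
theorem Expr.computes_compile {P : Program} {w : ℕ} {x y : BitVec w}
    {mem : BitVec w → BitVec w} (e : Expr) :
    ∀ (base d : ℕ) (c : Config w), 2 ≤ d → CodeAt P base (e.compile base d) → c.pc = base →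
      c.reg 0 = x → c.reg 1 = y → c.mem = mem →
      Computes P c base (e.compile base d).length d (e.eval x y mem) := by
  induction e with
  | x =>
    intro base d c _ hP hpc hx hy hm
    exact computes_of_step hpc hP (by rw [Instr.exec, hx, Expr.eval])
  | y =>
    intro base d c _ hP hpc hx hy hm
    exact computes_of_step hpc hP (by rw [Instr.exec, hy, Expr.eval])
  | const k =>
    intro base d c _ hP hpc hx hy hm
    exact computes_of_step hpc hP (by rw [Instr.exec, Expr.eval])
  | bin op a b iha ihb =>
    intro base d c hd hP hpc hx hy hm
    simp only [Expr.compile, List.length_append, List.length_singleton] at hP ⊢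
    refine (iha base d c hd hP.left hpc hx hy hm).trans_operands
      (fun c' e1 e3 e4 => ihb _ _ c' (by omega) hP.right.left e1 (by rw [e3 0 (by omega), hx])
        (by rw [e3 1 (by omega), hy]) (by rw [e4, hm])) (fun c' e1 e2 e3 => ?_)
    exact computes_of_step e1 hP.right.right (by rw [Instr.exec, e2, e3, Expr.eval])
  | load a iha =>
    intro base d c hd hP hpc hx hy hm
    simp only [Expr.compile, List.length_append, List.length_singleton] at hP ⊢
    refine (iha base d c hd hP.left hpc hx hy hm).trans_of_le (fun c' e1 e2 e3 e4 => ?_)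
    exact computes_of_step e1 hP.right (by rw [Instr.exec, e2, e4, hm, Expr.eval])
  | eq a b iha ihb =>
    intro base d c hd hP hpc hx hy hm
    simp only [Expr.compile, List.length_append] at hP ⊢
    refine (iha base d c hd hP.left hpc hx hy hm).trans_operands
      (fun c' e1 e3 e4 => ihb _ _ c' (by omega) hP.right.left e1 (by rw [e3 0 (by omega), hx])
        (by rw [e3 1 (by omega), hy]) (by rw [e4, hm])) (fun c' e1 e2 e3 => ?_)
    have := computes_branch (decide (c'.reg d = c'.reg (d + 1))) e1 (by rw [Instr.exec])
      hP.right.right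
    rw [e2, e3] at this
    simpa [Expr.eval] using this
  | lt a b iha ihb =>
    intro base d c hd hP hpc hx hy hm
    simp only [Expr.compile, List.length_append] at hP ⊢
    refine (iha base d c hd hP.left hpc hx hy hm).trans_operands
      (fun c' e1 e3 e4 => ihb _ _ c' (by omega) hP.right.left e1 (by rw [e3 0 (by omega), hx])
        (by rw [e3 1 (by omega), hy]) (by rw [e4, hm])) (fun c' e1 e2 e3 => ?_)
    have := computes_branch (decide ((c'.reg d).toNat < (c'.reg (d + 1)).toNat)) e1
      (by rw [Instr.exec]) hP.right.right
    rw [e2, e3] at this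
    simpa [Expr.eval] using this

/-- The program answering a query by the value of `e`. -/
def Expr.program (e : Expr) : Program := e.compile 0 2 ++ [.move 0 2]

theorem Expr.returnsWithin_program (e : Expr) {L : ℕ} (d : BitVec L) {w : ℕ} (x y : BitVec w) :
    ReturnsWithin e.program e.program.length (initConfig d x y)
      (e.eval x y (memImage d w)) := by
  have hP : CodeAt e.program 0 (e.compile 0 2 ++ [.move 0 2]) := by
    intro i _
    rw [zero_add, Expr.program]
  obtain ⟨t, ht, h1, h2, -, -⟩ := e.computes_compile (P := e.program) (x := x) (y := y)
    (mem := memImage d w) 0 2 (initConfig d x y) le_rfl hP.left rfl rfl rfl rfl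
  have hlen : e.program.length = (e.compile 0 2).length + 1 := by simp [Expr.program]
  have h0 : e.program[0 + (e.compile 0 2).length]? = some (.move 0 2) := by
    simpa using hP.right 0 (by simp)
  refine ⟨t + 1, by omega, ?_⟩
  rw [Function.iterate_succ_apply', step_of_getElem? h1 h0, Instr.exec]
  constructor
  · simp [Halted, Config.setReg, h1, hlen]
  · simp [Config.setReg, h2]

end WordRAM

/-! ### Combinatorics and arithmetic of the encoding -/

/-- The alias method: the weights `g` are distributed over bins of almost equal capacities `c`
such that every bin `j` holds a whole item `a j` (in its positions below `t j`) and
a contiguous piece, starting at `o j`, of one other item `b j`. -/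
theorem exists_alias_distribution (q : ℕ) (c : ℕ → ℕ) (J : Finset ℕ) :
    ∀ (S : Finset ℕ) (g : ℕ → ℕ), S.card = J.card → ∑ i ∈ S, g i = ∑ j ∈ J, c j →
      (∀ j ∈ J, q ≤ c j ∧ c j ≤ q + 1) →
      ∃ t a b o : ℕ → ℕ, (∀ j ∈ J, t j ≤ c j) ∧ ∀ i ∈ S, ∀ u < g i, ∃ j ∈ J, ∃ p < c j,
        (p < t j ∧ a j = i ∧ p = u) ∨ (t j ≤ p ∧ b j = i ∧ o j + (p - t j) = u) := by
  induction J using Finset.induction_on with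
  | empty =>
    intro S g hS _ _
    rw [Finset.card_empty, Finset.card_eq_zero] at hS
    subst hS
    exact ⟨0, 0, 0, 0, by simp, by simp⟩
  | insert j₀ J hj ih =>
    intro S g hS hsum hc
    rw [Finset.card_insert_of_notMem hj] at hS
    rw [Finset.sum_insert hj] at hsum
    have hne : S.Nonempty := by rw [← Finset.card_pos]; omega
    obtain ⟨a₀, ha, hmin⟩ := S.exists_min_image g hne
    obtain ⟨b₀, hb, hmax⟩ := S.exists_max_image g hne
    have hc0 := hc j₀ (by simp)
    have hcJ : ∀ j ∈ J, q ≤ c j ∧ c j ≤ q + 1 := fun j h => hc j (by simp [h])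
    -- Averaging: there are as many items as bins and capacities differ by at most one, so the
    -- lightest item fits into the bin and, below, the heaviest one can fill it.
    have hle : g a₀ ≤ c j₀ := by
      by_contra! hlt
      have h1 : S.card • (c j₀ + 1) ≤ ∑ i ∈ S, g i :=
        Finset.card_nsmul_le_sum S g _ fun i hi => by have := hmin i hi; omega
      have h2 : ∑ j ∈ J, c j ≤ J.card • (c j₀ + 1) :=
        Finset.sum_le_card_nsmul J c _ fun j hj => by have := hcJ j hj; omega
      rw [hS, smul_eq_mul, add_mul] at h1
      rw [smul_eq_mul] at h2
      omega
    have hge : c j₀ ≤ g b₀ := by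
      by_contra! hlt
      have h1 : ∑ i ∈ S, g i ≤ S.card • (c j₀ - 1) :=
        Finset.sum_le_card_nsmul S g _ fun i hi => by have := hmax i hi; omega
      have h2 : J.card • (c j₀ - 1) ≤ ∑ j ∈ J, c j :=
        Finset.card_nsmul_le_sum J c _ fun j hj => by have := hcJ j hj; omega
      rw [hS, smul_eq_mul, add_mul] at h1
      rw [smul_eq_mul] at h2
      omega
    -- The bin takes the top end of `b₀`, from `r` on. What is left of an item is thus always an
    -- initial segment, which is why the pieces `a j` need no offset.
    set r := g b₀ - (c j₀ - g a₀) with hr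
    set g' := Function.update g b₀ r with hg'
    have hS' : (S.erase a₀).card = J.card := by rw [Finset.card_erase_of_mem ha]; omega
    have hsum' : ∑ i ∈ S.erase a₀, g' i = ∑ j ∈ J, c j := by
      have e1 := Finset.add_sum_erase S g ha
      -- If both items coincide, the item fills the bin exactly and nothing is left over.
      by_cases hab : b₀ = a₀
      · have : ∑ i ∈ S.erase a₀, g' i = ∑ i ∈ S.erase a₀, g i := by
          refine Finset.sum_congr rfl fun i hi => ?_
          rw [hg', hab, Function.update_of_ne (Finset.ne_of_mem_erase hi)]
        rw [hab] at hge
        omega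
      · have hb' : b₀ ∈ S.erase a₀ := Finset.mem_erase.2 ⟨hab, hb⟩
        have e2 := Finset.add_sum_erase _ g hb'
        have e3 : ∑ i ∈ S.erase a₀, g' i = _ := Finset.sum_update_of_mem hb' g r
        rw [← Finset.erase_eq] at e3
        omega
    obtain ⟨t, a, b, o, ht, H⟩ := ih (S.erase a₀) g' hS' hsum' hcJ
    refine ⟨Function.update t j₀ (g a₀), Function.update a j₀ a₀, Function.update b j₀ b₀,
      Function.update o j₀ r, ?_, ?_⟩
    · intro j hj'
      by_cases h : j = j₀
      · subst h; simpa using hle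
      · rw [Function.update_of_ne h]
        exact ht j ((Finset.mem_insert.1 hj').resolve_left h)
    · intro i hi u hu
      by_cases hia : i = a₀
      · subst hia
        exact ⟨j₀, by simp, u, by omega, Or.inl (by simp [hu])⟩
      by_cases hib : i = b₀ ∧ r ≤ u
      · obtain ⟨rfl, hru⟩ := hib
        refine ⟨j₀, by simp, g a₀ + (u - r), by omega, Or.inr ?_⟩
        simp only [Function.update_self]
        exact ⟨by omega, trivial, by omega⟩
      · have hu' : u < g' i := by
          by_cases hib' : i = b₀
          · rw [hg', hib', Function.update_self]
            by_contra h
            exact hib ⟨hib', by omega⟩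
          · rwa [hg', Function.update_of_ne hib']
        obtain ⟨j, hjJ, p, hp, h⟩ := H i (Finset.mem_erase.2 ⟨hia, hi⟩) u hu'
        refine ⟨j, by simp [hjJ], p, hp, ?_⟩
        have : j ≠ j₀ := fun e => hj (e ▸ hjJ)
        simpa [Function.update_of_ne this] using h

/-- Division by `s` on an interval of length `2 ^ m` by one multiplication and one shift of
numbers with about `2 * m` bits. -/
theorem exists_reciprocal (m s o : ℕ) (hs : 0 < s) :
    ∃ F M h e : ℕ, F ≤ 2 ^ m ∧ M < 2 ^ (2 * m + 4) ∧ h < 2 ^ (2 * m + 4) ∧ e ≤ o ∧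
      ∀ p < 2 ^ m, (p + F) * M < 2 ^ (2 * m + 4) ∧ (p + F) * M / 2 ^ h + e = (o + p) / s := by
  set Q := 2 ^ m with hQ
  have hQ0 : 0 < Q := by positivity
  have e0 : 2 ^ (2 * m + 4) = 16 * (Q * Q) := by rw [hQ]; ring
  have hmQ : m < Q := Nat.lt_two_pow_self
  have hQQ : Q ≤ Q * Q := Nat.le_mul_of_pos_left _ hQ0
  have ho := Nat.div_add_mod o s
  have hf := Nat.mod_lt o hs
  have heo : o / s ≤ o := Nat.div_le_self o s
  set f := o % s
  set e := o / s
  -- The full multiples of `s` in the offset go into `e`; only the remainder `f` matters from here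
  -- on.
  have hsplit : ∀ p, (o + p) / s = (p + f) / s + e := by
    intro p
    rw [← ho, show s * e + f + p = p + f + e * s by ring, Nat.add_mul_div_right _ _ hs]
  rw [e0]
  by_cases hsQ : s < Q
  · have hl : s < 2 ^ s.size := Nat.lt_size_self s
    have hl' : 2 ^ s.size ≤ 2 * s := by
      have h1 : s.size - 1 < s.size := by
        have := Nat.size_pos.2 hs; omega
      have h2 := Nat.lt_size.1 h1
      have h3 : 2 ^ s.size = 2 * 2 ^ (s.size - 1) := by
        rw [← pow_succ']; congr 1; omega
      omega
    have hsz : s.size ≤ m := Nat.size_le.2 hsQ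
    -- The scale satisfies 2Qs < H ≤ 4Qs. The lower bound makes the reciprocal `H / s + 1` exact
    -- enough for arguments below 2Q; the upper bound keeps it at most 4Q + 1, so products stay
    -- below 16Q².
    set H := 2 ^ (m + 1 + s.size) with hH
    have hHe : H = 2 * Q * 2 ^ s.size := by rw [hH, pow_add, pow_succ]; ring
    have hH1 : 2 * Q * s < H := by rw [hHe]; exact Nat.mul_lt_mul_of_pos_left hl (by omega)
    have hH2 : H ≤ 4 * Q * s := by rw [hHe]; nlinarith
    have hd := Nat.div_add_mod H s
    have hdm := Nat.mod_lt H hs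
    have hM : H / s ≤ 4 * Q := by
      rw [← Nat.mul_div_cancel (4 * Q) hs]
      exact Nat.div_le_div_right hH2
    refine ⟨f, H / s + 1, m + 1 + s.size, e, by omega, by nlinarith, by omega, heo, ?_⟩
    intro p hp
    rw [hsplit, ← hH]
    refine ⟨by nlinarith, ?_⟩
    congr 1
    have hz : p + f < 2 * Q := by omega
    set z := p + f
    have hzd := Nat.div_add_mod z s
    have hzm := Nat.mod_lt z hs
    set D := H / s
    set ε := H % s
    set v := z / s
    set y := z % s
    -- `s * (D + 1) = H + (s - ε)`
    apply Nat.div_eq_of_lt_le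
    · have : s * (v * H) ≤ s * (z * (D + 1)) := by
        calc s * (v * H) = (s * v) * H := by ring
          _ ≤ z * (s * D + s) := Nat.mul_le_mul (by omega) (by omega)
          _ = s * (z * (D + 1)) := by ring
      exact Nat.le_of_mul_le_mul_left this hs
    -- Rounding the reciprocal up adds at most `z * s` to `z * H`. This is less than 2Qs < H, too
    -- little to reach the next quotient.
    · have : s * (z * (D + 1)) < s * ((v + 1) * H) := by
        have h1 : s * (v + 1) ≥ z + 1 := by rw [mul_add, mul_one]; omega
        calc s * (z * (D + 1)) = z * (s * D + s) := by ring
          _ ≤ z * (H + s) := Nat.mul_le_mul le_rfl (by omega)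
          _ = z * H + z * s := by ring
          _ < z * H + H := by nlinarith
          _ = (z + 1) * H := by ring
          _ ≤ (s * (v + 1)) * H := Nat.mul_le_mul h1 le_rfl
          _ = s * ((v + 1) * H) := by ring
      exact Nat.lt_of_mul_lt_mul_left this
  -- Now p < Q ≤ s and f < s, so (p + f) / s is 0 or 1. If the interval does not reach s, it is
  -- constantly 0 and the multiplier 0 serves.
  · push Not at hsQ
    by_cases hcross : Q ≤ s - f
    · refine ⟨0, 0, 0, e, by omega, by omega, by omega, heo, fun p hp => ⟨by omega, ?_⟩⟩
      rw [hsplit, Nat.div_eq_of_lt (show p + f < s by omega)]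
      simp
    -- The shift by `F` moves the only jump of the quotient, at p = s - f, to the power of two Q,
    -- where a bit shift detects it.
    · refine ⟨Q - (s - f), 1, m, e, by omega, by omega, by omega, heo,
        fun p hp => ⟨by omega, ?_⟩⟩
      rw [hsplit, mul_one, ← hQ]
      congr 1
      by_cases hps : p + f < s
      · rw [Nat.div_eq_of_lt hps, Nat.div_eq_of_lt (by omega)]
      · rw [Nat.div_eq_of_lt_le (k := 1) (by omega) (by omega),
          Nat.div_eq_of_lt_le (k := 1) (by omega) (by omega)]

/-- Coordinates of the elements of a finite type with respect to a partition: the size `s` of the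
class, and an index `u` among the elements of classes of that size, consecutive in each class. -/
theorem exists_class_coordinates {α : Type*} [Fintype α] (r : Setoid α) :
    ∃ (T : Finset ℕ) (g : ℕ → ℕ) (s u : α → ℕ),
      (∑ i ∈ T, g i = Fintype.card α) ∧ (∀ i ∈ T, 0 < i ∧ i ≤ g i) ∧
      (∀ x, s x ∈ T ∧ u x < g (s x)) ∧
      (∀ x y, s x = s y → u x = u y → x = y) ∧
      ∀ x y, r x y ↔ s x = s y ∧ u x / s x = u y / s y := by
  classical
  let cls : Quotient r → Finset α := fun Q => {z | ⟦z⟧ = Q}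
  let sz : Quotient r → ℕ := fun Q => (cls Q).card
  let same : ℕ → Finset (Quotient r) := fun i => {Q | sz Q = i}
  have hmemc : ∀ x : α, x ∈ cls ⟦x⟧ := fun x => by simp [cls]
  have hmems : ∀ Q, Q ∈ same (sz Q) := fun Q => by simp [same]
  have hszpos : ∀ Q, 0 < sz Q := by
    intro Q
    induction Q using Quotient.inductionOn with
    | h a => exact Finset.card_pos.2 ⟨a, hmemc a⟩
  let ci : Quotient r → ℕ := fun Q => ((same (sz Q)).equivFin ⟨Q, hmems Q⟩ : ℕ)
  let ei : α → ℕ := fun x => ((cls ⟦x⟧).equivFin ⟨x, hmemc x⟩ : ℕ)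
  have hci : ∀ Q, ci Q < (same (sz Q)).card := fun Q => Fin.is_lt _
  have hei : ∀ x, ei x < sz ⟦x⟧ := fun x => Fin.is_lt _
  have hciinj : ∀ Q R, sz Q = sz R → ci Q = ci R → Q = R := by
    intro Q R h h'
    -- The numbering of the classes of size `sz Q` depends on `Q` through its type; both numberings
    -- are transported to a common size `i` before injectivity applies.
    have key : ∀ (i : ℕ) (hi : sz Q = i) (hj : sz R = i),
        (((same i).equivFin ⟨Q, hi ▸ hmems Q⟩ : Fin _) : ℕ) =
          ((same i).equivFin ⟨R, hj ▸ hmems R⟩ : Fin _) → Q = R := by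
      intro i hi hj e
      have := (same i).equivFin.injective (Fin.ext e)
      simpa using this
    have hcast : ∀ (i : ℕ) (hi : sz Q = i),
        (((same i).equivFin ⟨Q, hi ▸ hmems Q⟩ : Fin _) : ℕ) = ci Q := by
      rintro _ rfl
      rfl
    exact key (sz R) h rfl ((hcast _ h).trans h')
  have heiinj : ∀ x y : α, (⟦x⟧ : Quotient r) = ⟦y⟧ → ei x = ei y → x = y := by
    intro x y h h'
    have key : ∀ (Q : Quotient r) (hi : ⟦x⟧ = Q) (hj : ⟦y⟧ = Q),
        (((cls Q).equivFin ⟨x, hi ▸ hmemc x⟩ : Fin _) : ℕ) =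
          ((cls Q).equivFin ⟨y, hj ▸ hmemc y⟩ : Fin _) → x = y := by
      intro Q hi hj e
      have := (cls Q).equivFin.injective (Fin.ext e)
      simpa using this
    have hcast : ∀ (Q : Quotient r) (hi : ⟦x⟧ = Q),
        (((cls Q).equivFin ⟨x, hi ▸ hmemc x⟩ : Fin _) : ℕ) = ei x := by
      rintro _ rfl
      rfl
    exact key ⟦y⟧ h rfl ((hcast _ h).trans h')
  let s : α → ℕ := fun x => sz ⟦x⟧
  -- Classes of equal size are laid end to end, so division by the size returns the number of the
  -- class.
  let u : α → ℕ := fun x => ci ⟦x⟧ * sz ⟦x⟧ + ei x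
  have hdiv : ∀ x, u x / s x = ci ⟦x⟧ := by
    intro x
    simp only [u, s]
    rw [mul_comm, Nat.mul_add_div (hszpos _), Nat.div_eq_of_lt (hei x), add_zero]
  have hrel : ∀ x y, r x y ↔ s x = s y ∧ u x / s x = u y / s y := by
    intro x y
    rw [hdiv, hdiv]
    constructor
    · intro h
      have : (⟦x⟧ : Quotient r) = ⟦y⟧ := Quotient.sound h
      simp only [s, this, and_self]
    · rintro ⟨h1, h2⟩
      exact Quotient.exact (hciinj _ _ h1 h2)
  refine ⟨Finset.univ.image sz, fun i => (same i).card * i, s, u, ?_, ?_, ?_, ?_, hrel⟩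
  · have h1 : Fintype.card α = ∑ Q : Quotient r, sz Q :=
      Finset.card_eq_sum_card_fiberwise (f := fun x : α => (⟦x⟧ : Quotient r))
        (fun _ _ => Finset.mem_coe.2 (Finset.mem_univ _))
    rw [h1, ← Finset.sum_fiberwise_of_maps_to
      (fun Q _ => Finset.mem_image_of_mem sz (Finset.mem_univ Q))]
    refine Finset.sum_congr rfl fun i _ => ?_
    rw [Finset.sum_const_nat (m := i)]
    intro Q hQ
    simpa using hQ
  · intro i hi
    obtain ⟨Q, -, rfl⟩ := Finset.mem_image.1 hi
    exact ⟨hszpos Q, Nat.le_mul_of_pos_left _ (Finset.card_pos.2 ⟨Q, hmems Q⟩)⟩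
  · intro x
    refine ⟨Finset.mem_image_of_mem _ (Finset.mem_univ _), ?_⟩
    have h1 := hci ⟦x⟧
    have h2 := hei x
    simp only [u, s]
    calc ci ⟦x⟧ * sz ⟦x⟧ + ei x < (ci ⟦x⟧ + 1) * sz ⟦x⟧ := by rw [add_mul]; omega
      _ ≤ _ := Nat.mul_le_mul h1 le_rfl
  · intro x y hs hu
    have hQ : (⟦x⟧ : Quotient r) = ⟦y⟧ := Quotient.sound ((hrel x y).2 ⟨hs, by rw [hs, hu]⟩)
    refine heiinj x y hQ ?_
    simp only [u, hQ] at hu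
    omega

/-- A set of positive numbers with a small sum has few elements. -/
theorem card_le_of_sum_le {T : Finset ℕ} {K n : ℕ} (hpos : ∀ i ∈ T, 0 < i)
    (hsum : ∑ i ∈ T, i ≤ n) (hn : 8 * n ≤ K * K) : T.card ≤ K := by
  -- At most K / 2 members are ≤ K / 2. Were there more than K members, over K / 2 of them would
  -- exceed K / 2, and their sum alone would exceed K² / 4 ≥ 2n.
  have h1 : (T.filter (· ≤ K / 2)).card ≤ K / 2 := by
    have : T.filter (· ≤ K / 2) ⊆ Finset.Icc 1 (K / 2) := by
      intro i hi
      rw [Finset.mem_filter] at hi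
      exact Finset.mem_Icc.2 ⟨hpos i hi.1, hi.2⟩
    simpa using Finset.card_le_card this
  have h2 : (T.filter (¬ · ≤ K / 2)).card • (K / 2 + 1) ≤ n := by
    refine le_trans (Finset.card_nsmul_le_sum _ (fun i => i) _ ?_)
      (le_trans (Finset.sum_le_sum_of_subset (Finset.filter_subset _ _)) hsum)
    intro i hi
    have := (Finset.mem_filter.1 hi).2
    omega
  have h3 := Finset.card_filter_add_card_filter_not (s := T) (· ≤ K / 2)
  rw [smul_eq_mul] at h2
  set A := (T.filter (¬ · ≤ K / 2)).card
  have h4 : K ≤ 2 * (K / 2) + 1 := by omega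
  by_contra! hlt
  have h5 : K / 2 < A := by omega
  nlinarith

/-- A number and its two's complement have exactly the lowest set bit in common. -/
theorem Nat.and_two_pow_sub_of_mod {v w b : ℕ} (hv : v < 2 ^ w)
    (h : v % 2 ^ (b + 1) = 2 ^ b) : v &&& (2 ^ w - v) % 2 ^ w = 2 ^ b := by
  obtain ⟨u, hu⟩ : ∃ u, v = 2 ^ (b + 1) * u + 2 ^ b :=
    ⟨v / 2 ^ (b + 1), by have := Nat.div_add_mod v (2 ^ (b + 1)); omega⟩
  have hb : 0 < 2 ^ b := by positivity
  have hpow : 2 ^ b < 2 ^ (b + 1) := by rw [pow_succ]; omega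
  have hv1 : v = (2 ^ (b + 1) * u + (2 ^ b - 1)) + 1 := by omega
  rw [Nat.mod_eq_of_lt (by omega)]
  refine Nat.eq_of_testBit_eq fun i => ?_
  rw [Nat.testBit_and]
  -- The two's complement of v is the bitwise complement of v - 1. The number v - 1 agrees with v
  -- above bit b, has 0 at bit b and ones below.
  conv_lhs => arg 2; rw [hv1]
  rw [Nat.testBit_two_pow_sub_succ (by omega), hu,
    Nat.testBit_two_pow_mul_add u hpow, Nat.testBit_two_pow_mul_add u (by omega),
    Nat.testBit_two_pow_sub_one, Nat.testBit_two_pow]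
  rcases lt_trichotomy i b with hi | rfl | hi
  · simp [hi, Nat.lt_succ_of_lt hi, hi.ne']
  · have hiw : i < w := (Nat.pow_lt_pow_iff_right (le_refl 2)).1 (by omega : 2 ^ i < 2 ^ w)
    simp [hiw]
  · simp only [show ¬ i < b + 1 by omega, hi.ne, if_false, decide_false]
    cases u.testBit (i - (b + 1)) <;> simp

/-! ### Values of word expressions and the query expression -/

namespace WordRAM

/-- The expression `e` has value `v`. -/
def Expr.HasValue {w : ℕ} (x y : BitVec w) (mem : BitVec w → BitVec w) (e : Expr) (v : ℕ) : Prop :=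
  (e.eval x y mem).toNat = v

namespace Expr

section Values

variable {w : ℕ} {x y : BitVec w} {mem : BitVec w → BitVec w} {a b : Expr} {u v : ℕ}

theorem HasValue.lt_two_pow (ha : HasValue x y mem a u) : u < 2 ^ w :=
  ha ▸ BitVec.isLt _

theorem hasValue_const (hu : u < 2 ^ w) : HasValue x y mem (.const u) u := by
  simp [HasValue, eval, Nat.mod_eq_of_lt hu]

theorem HasValue.add (ha : HasValue x y mem a u) (hb : HasValue x y mem b v)
    (h : u + v < 2 ^ w) : HasValue x y mem (.bin .add a b) (u + v) := by
  unfold HasValue at *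
  rw [eval, BinOp.eval, BitVec.toNat_add, ha, hb, Nat.mod_eq_of_lt h]

theorem HasValue.mul (ha : HasValue x y mem a u) (hb : HasValue x y mem b v)
    (h : u * v < 2 ^ w) : HasValue x y mem (.bin .mul a b) (u * v) := by
  unfold HasValue at *
  rw [eval, BinOp.eval, BitVec.toNat_mul, ha, hb, Nat.mod_eq_of_lt h]

theorem HasValue.sub (ha : HasValue x y mem a u) (hb : HasValue x y mem b v)
    (h : v ≤ u) : HasValue x y mem (.bin .sub a b) (u - v) := by
  have hu := ha.lt_two_pow
  unfold HasValue at *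
  rw [eval, BinOp.eval, BitVec.toNat_sub_of_le (by rw [BitVec.le_def]; omega), ha, hb]

theorem HasValue.and (ha : HasValue x y mem a u) (hb : HasValue x y mem b v) :
    HasValue x y mem (.bin .and a b) (u &&& v) := by
  unfold HasValue at *
  rw [eval, BinOp.eval, BitVec.toNat_and, ha, hb]

theorem HasValue.or (ha : HasValue x y mem a u) (hb : HasValue x y mem b v) :
    HasValue x y mem (.bin .or a b) (u ||| v) := by
  unfold HasValue at *
  rw [eval, BinOp.eval, BitVec.toNat_or, ha, hb]

theorem HasValue.shr (ha : HasValue x y mem a u) (hb : HasValue x y mem b v) :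
    HasValue x y mem (.bin .shr a b) (u / 2 ^ v) := by
  unfold HasValue at *
  rw [eval, BinOp.eval, BitVec.ushiftRight_eq', BitVec.toNat_ushiftRight, ha, hb,
    Nat.shiftRight_eq_div_pow]

theorem HasValue.shl (ha : HasValue x y mem a u) (hb : HasValue x y mem b v)
    (h : u * 2 ^ v < 2 ^ w) : HasValue x y mem (.bin .shl a b) (u * 2 ^ v) := by
  unfold HasValue at *
  rw [eval, BinOp.eval, BitVec.shiftLeft_eq', BitVec.toNat_shiftLeft, ha, hb,
    Nat.shiftLeft_eq, Nat.mod_eq_of_lt h]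

theorem HasValue.load (ha : HasValue x y mem a u) :
    HasValue x y mem (.load a) (mem (BitVec.ofNat w u)).toNat := by
  unfold HasValue at *
  rw [eval, ← ha, BitVec.ofNat_toNat, BitVec.setWidth_eq]

theorem HasValue.lt (ha : HasValue x y mem a u) (hb : HasValue x y mem b v) (hw : 0 < w) :
    HasValue x y mem (.lt a b) (if u < v then 1 else 0) := by
  have : 1 < 2 ^ w := Nat.one_lt_two_pow hw.ne'
  unfold HasValue at *
  rw [eval, ha, hb]
  split_ifs <;> simp [Nat.mod_eq_of_lt this]

theorem HasValue.eq (ha : HasValue x y mem a u) (hb : HasValue x y mem b v) (hw : 0 < w) :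
    HasValue x y mem (.eq a b) (if u = v then 1 else 0) := by
  have : 1 < 2 ^ w := Nat.one_lt_two_pow hw.ne'
  unfold HasValue at *
  simp only [eval, ← BitVec.toNat_inj, ha, hb]
  split_ifs <;> simp [Nat.mod_eq_of_lt this]

/-- The `b` lowest bits of `a`. -/
def lowBits (a b : Expr) : Expr :=
  .bin .and a (.bin .sub (.bin .shl (.const 1) b) (.const 1))

theorem HasValue.lowBits (ha : HasValue x y mem a u) (hb : HasValue x y mem b v) (h : v < w) :
    HasValue x y mem (lowBits a b) (u % 2 ^ v) := by
  have h1 : HasValue x y mem (.const 1) 1 := hasValue_const (Nat.one_lt_two_pow (by omega))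
  have h2 := h1.shl hb (by rw [one_mul]; exact Nat.pow_lt_pow_right (by omega) h)
  have h3 := ha.and (h2.sub h1 (by rw [one_mul]; exact Nat.one_le_two_pow))
  rwa [one_mul, Nat.and_two_pow_sub_one_eq_mod] at h3

/-- The lowest set bit of `a`. -/
def lowestBit (a : Expr) : Expr := .bin .and a (.bin .sub (.const 0) a)

theorem HasValue.lowestBit (ha : HasValue x y mem a u) (h : u % 2 ^ (v + 1) = 2 ^ v) :
    HasValue x y mem (lowestBit a) (2 ^ v) := by
  have hu := ha.lt_two_pow
  rw [← Nat.and_two_pow_sub_of_mod hu h]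
  unfold HasValue at *
  rw [Expr.lowestBit, eval, BinOp.eval, BitVec.toNat_and, ha, eval, BinOp.eval, BitVec.toNat_sub,
    ha, eval]
  simp

end Values

/-- The first memory word, which starts with the parameters of the layout. -/
def header : Expr := .load (.const 0)

/-- The width of the fields into which the memory is divided. -/
def width : Expr := lowestBit header

/-- The binary logarithm of the number of fields in a memory word. -/
def logPerWord : Expr := lowBits (.bin .shr header width) width

/-- The binary logarithm of the number of bins. -/
def logBins : Expr := lowBits (.bin .shr header (.bin .add width width)) width

/-- The field with index `f`. -/
def field (f : Expr) : Expr :=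
  lowBits (.bin .shr (.load (.bin .shr f logPerWord)) (.bin .mul (lowBits f logPerWord) width))
    width

/-- The number formed by the first `r` of the eight fields of the slot with index `i`. -/
def slotPrefix (i : Expr) : ℕ → Expr
  | 0 => .const 0
  | r + 1 => .bin .add (slotPrefix i r)
      (.bin .shl (field (.bin .add (.bin .mul (.const 8) i) (.const r)))
        (.bin .mul (.const r) width))

/-- The number stored in the slot with index `i`. -/
def slot (i : Expr) : Expr := slotPrefix i 8

/-- The position in its bin of the element with label `z`. -/
def binPos (z : Expr) : Expr := .bin .shr (.bin .sub z (.const 1)) logBins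

/-- The index of the first slot of the bin of the element with label `z`. -/
def binSlot (z : Expr) : Expr :=
  .bin .mul (.const 16) (lowBits (.bin .sub z (.const 1)) logBins)

/-- The length of the first piece of the bin. -/
def threshold (z : Expr) : Expr := slot (.bin .add (binSlot z) (.const 1))

/-- The index (`0` or `1`) of the piece of the bin containing `z`. -/
def piece (z : Expr) : Expr := .bin .sub (.const 1) (.lt (binPos z) (threshold z))

/-- The `i`-th entry in the description of the piece containing `z`. -/
def pieceEntry (z : Expr) (i : ℕ) : Expr :=
  slot (.bin .add (binSlot z) (.bin .add (.bin .mul (.const 8) (piece z)) (.const i)))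

/-- The position of `z` in its piece. -/
def piecePos (z : Expr) : Expr := .bin .sub (binPos z) (.bin .mul (piece z) (threshold z))

/-- The size of the class of `z`. -/
def classSize (z : Expr) : Expr := pieceEntry z 2

/-- The index of the class of `z` among the classes of the same size. -/
def classIndex (z : Expr) : Expr :=
  .bin .add (.bin .shr (.bin .mul (.bin .add (piecePos z) (pieceEntry z 3)) (pieceEntry z 4))
    (pieceEntry z 5)) (pieceEntry z 6)

/-- Equivalence of the query elements, for words of at least 32 bits. -/
def equivLarge : Expr :=
  .bin .or (.eq .x .y)
    (.bin .and (.eq (classSize .x) (classSize .y)) (.eq (classIndex .x) (classIndex .y)))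

/-- Equivalence of the query elements. For words of at most 31 bits, the memory is a table of
class numbers. -/
def equivQuery : Expr :=
  .bin .or (.bin .and (.eq (.const (2 ^ 31)) (.const 0)) (.eq (.load .x) (.load .y)))
    (.bin .and (.bin .sub (.const 1) (.eq (.const (2 ^ 31)) (.const 0))) equivLarge)

end Expr

/-! ### Packed memory layout and reading from it -/

/-- The parameters of a memory layout for words of `w` bits: fields of width `2 ^ logWidth`,
`2 ^ g` fields per word, and `2 ^ (k + 7)` fields altogether. -/
structure Layout (w : ℕ) where
  logWidth : ℕ
  g : ℕ
  k : ℕ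
  two_le_g : 2 ≤ g
  g_lt : g < 2 ^ 2 ^ logWidth
  k_lt : k < 2 ^ 2 ^ logWidth
  k_add_le : k + 7 ≤ w
  fit : 2 ^ g * 2 ^ logWidth ≤ w
  g_le : g ≤ k + 7
  full : g = k + 7 ∨ w ≤ 2 ^ (g + 1) * 2 ^ logWidth

namespace Layout

variable {w : ℕ} (Λ : Layout w) (val : ℕ → ℕ)

/-- The field width. -/
abbrev width : ℕ := 2 ^ Λ.logWidth

/-- The content of slot `0`. -/
def header : ℕ := Λ.width + 2 ^ Λ.width * (Λ.g + 2 ^ Λ.width * Λ.k)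

/-- The data structure with the numbers `val i` in its slots. -/
def data : BitVec (2 ^ (Λ.k + 8) * Λ.width) :=
  BitVec.ofNat _ (Nat.ofBits fun t : Fin (2 ^ (Λ.k + 8) * Λ.width) =>
    let f := (t / w) * 2 ^ Λ.g + (t % w) / Λ.width
    (val (f / 8) / 2 ^ (f % 8 * Λ.width)).testBit (t % w % Λ.width))

theorem width_pos : 0 < Λ.width := by positivity

theorem four_mul_width_le : 4 * Λ.width ≤ w := by
  have h1 := Nat.pow_le_pow_right (n := 2) (by omega) Λ.two_le_g
  exact le_trans (Nat.mul_le_mul_right _ h1) Λ.fit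

/-- Field `f` starts at bit (f mod 2^g) · width of word f / 2^g. Unused bits at the end of each word
are why the address arithmetic goes through words. -/
theorem field_memImage {f : ℕ} (hf : f < 2 ^ (Λ.k + 7)) :
    (memImage (Λ.data val) w (BitVec.ofNat w (f / 2 ^ Λ.g))).toNat /
        2 ^ (f % 2 ^ Λ.g * Λ.width) % 2 ^ Λ.width =
      val (f / 8) / 2 ^ (f % 8 * Λ.width) % 2 ^ Λ.width := by
  have hB := Λ.width_pos
  have hg : 0 < 2 ^ Λ.g := by positivity
  have hfit := Λ.fit
  have hfg := Nat.mod_lt f hg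
  have hfd := Nat.div_add_mod f (2 ^ Λ.g)
  have ha : f / 2 ^ Λ.g < 2 ^ w :=
    (Nat.div_le_self _ _).trans_lt (hf.trans_le (Nat.pow_le_pow_right (by omega) Λ.k_add_le))
  refine Nat.eq_of_testBit_eq fun i => ?_
  rw [Nat.testBit_mod_two_pow, Nat.testBit_mod_two_pow]
  by_cases hi : i < Λ.width
  swap
  · simp [hi]
  have hpos : i + f % 2 ^ Λ.g * Λ.width < 2 ^ Λ.g * Λ.width := by
    calc i + f % 2 ^ Λ.g * Λ.width < (f % 2 ^ Λ.g + 1) * Λ.width := by rw [add_mul]; omega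
      _ ≤ _ := Nat.mul_le_mul_right _ hfg
  have hposw : i + f % 2 ^ Λ.g * Λ.width < w := hpos.trans_le hfit
  -- By `full`, either one word holds all fields or the fields fill at least half of each word; so
  -- twice the net length of the fields suffices.
  have hL : f / 2 ^ Λ.g * w + (i + f % 2 ^ Λ.g * Λ.width) < 2 ^ (Λ.k + 8) * Λ.width := by
    rcases Λ.full with h | h
    · have h0 : f / 2 ^ Λ.g = 0 := Nat.div_eq_of_lt (h ▸ hf)
      rw [h0, zero_mul, zero_add]
      refine hpos.trans_le (Nat.mul_le_mul_right _ (Nat.pow_le_pow_right (by omega) (by omega)))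
    · have h1 : f / 2 ^ Λ.g + 1 ≤ 2 ^ (Λ.k + 7 - Λ.g) := by
        rw [Nat.succ_le_iff, Nat.div_lt_iff_lt_mul hg, ← pow_add, Nat.sub_add_cancel Λ.g_le]
        exact hf
      calc f / 2 ^ Λ.g * w + (i + f % 2 ^ Λ.g * Λ.width) < (f / 2 ^ Λ.g + 1) * w := by
            rw [add_mul]; omega
        _ ≤ 2 ^ (Λ.k + 7 - Λ.g) * (2 ^ (Λ.g + 1) * Λ.width) := Nat.mul_le_mul h1 h
        _ = 2 ^ (Λ.k + 8) * Λ.width := by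
            rw [← mul_assoc, ← pow_add]
            congr 2
            have := Λ.g_le
            omega
  have e1 : (f / 2 ^ Λ.g * w + (i + f % 2 ^ Λ.g * Λ.width)) / w = f / 2 ^ Λ.g := by
    rw [mul_comm, Nat.mul_add_div (by omega), Nat.div_eq_of_lt hposw, add_zero]
  have e2 : (f / 2 ^ Λ.g * w + (i + f % 2 ^ Λ.g * Λ.width)) % w =
      i + f % 2 ^ Λ.g * Λ.width := by
    rw [mul_comm, Nat.mul_add_mod, Nat.mod_eq_of_lt hposw]
  have e3 : (i + f % 2 ^ Λ.g * Λ.width) / Λ.width = f % 2 ^ Λ.g := by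
    rw [Nat.add_mul_div_right _ _ hB, Nat.div_eq_of_lt hi, zero_add]
  have e4 : (i + f % 2 ^ Λ.g * Λ.width) % Λ.width = i := by
    rw [Nat.add_mul_mod_self_right, Nat.mod_eq_of_lt hi]
  have e5 : f / 2 ^ Λ.g * 2 ^ Λ.g + f % 2 ^ Λ.g = f := by rw [mul_comm]; exact hfd
  congr 1
  rw [Nat.testBit_div_two_pow, BitVec.testBit_toNat, memImage, BitVec.getLsbD_extractLsb',
    BitVec.toNat_ofNat, Nat.mod_eq_of_lt ha, data, BitVec.getLsbD_ofNat,
    Nat.testBit_ofBits_lt _ _ hL]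
  simp only [e1, e2, e3, e4, e5, hposw, hL, decide_true, Bool.true_and]

section Reading

variable {Λ val} {x y : BitVec w}

local notation "HV" => Expr.HasValue x y (memImage (Layout.data Λ val) w)

/-- Since g ≥ 2, the first four fields lie in word 0, so the parameters can be read before g is
known. -/
theorem hasValue_header_mod (h0 : val 0 = Λ.header) :
    ∃ v, HV Expr.header v ∧ v % 2 ^ Λ.width = Λ.width ∧
      v / 2 ^ Λ.width % 2 ^ Λ.width = Λ.g ∧
      v / 2 ^ (Λ.width + Λ.width) % 2 ^ Λ.width = Λ.k := by
  have hg4 : 2 ^ 2 ≤ 2 ^ Λ.g := Nat.pow_le_pow_right (by omega) Λ.two_le_g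
  have hf4 : 2 ^ 7 ≤ 2 ^ (Λ.k + 7) := Nat.pow_le_pow_right (by omega) (by omega)
  have hwp : Λ.width < 2 ^ Λ.width := Nat.lt_two_pow_self
  have key : ∀ f < 4, (memImage (Λ.data val) w (BitVec.ofNat w 0)).toNat /
      2 ^ (f * Λ.width) % 2 ^ Λ.width = Λ.header / 2 ^ (f * Λ.width) % 2 ^ Λ.width := by
    intro f hf
    have := Λ.field_memImage val (f := f) (by omega)
    rwa [Nat.mod_eq_of_lt (show f < 2 ^ Λ.g by omega),
      Nat.div_eq_of_lt (show f < 2 ^ Λ.g by omega), Nat.div_eq_of_lt (show f < 8 by omega),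
      Nat.mod_eq_of_lt (show f < 8 by omega), h0] at this
  refine ⟨_, (Expr.hasValue_const (by positivity)).load, ?_, ?_, ?_⟩
  · have := key 0 (by omega)
    rw [zero_mul, pow_zero, Nat.div_one, Nat.div_one] at this
    rw [this, header, Nat.add_mul_mod_self_left, Nat.mod_eq_of_lt hwp]
  · have := key 1 (by omega)
    rw [one_mul] at this
    rw [this, header, Nat.add_mul_div_left _ _ (by positivity), Nat.div_eq_of_lt hwp, zero_add,
      Nat.add_mul_mod_self_left, Nat.mod_eq_of_lt Λ.g_lt]
  · have := key 2 (by omega)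
    rw [two_mul] at this
    rw [this, pow_add, ← Nat.div_div_eq_div_mul, header,
      Nat.add_mul_div_left _ _ (by positivity), Nat.div_eq_of_lt hwp, zero_add,
      Nat.add_mul_div_left _ _ (by positivity), Nat.div_eq_of_lt Λ.g_lt, zero_add,
      Nat.mod_eq_of_lt Λ.k_lt]

theorem width_lt : Λ.width < w := by
  have := Λ.four_mul_width_le
  have := Λ.width_pos
  omega

/-- The first field holds the width, a nonzero power of two; hence it is the lowest set bit of the
word, and it can be isolated without knowing where the field ends. -/
theorem hasValue_width (h0 : val 0 = Λ.header) : HV Expr.width Λ.width := by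
  obtain ⟨v, hv, h1, -, -⟩ := hasValue_header_mod (x := x) (y := y) h0
  refine hv.lowestBit ?_
  have hle : Λ.logWidth + 1 ≤ Λ.width := Nat.lt_two_pow_self
  rw [← Nat.mod_mod_of_dvd v (pow_dvd_pow 2 hle), h1]
  exact Nat.mod_eq_of_lt (Nat.pow_lt_pow_right (by omega) (by omega))

theorem hasValue_logPerWord (h0 : val 0 = Λ.header) : HV Expr.logPerWord Λ.g := by
  obtain ⟨v, hv, -, h1, -⟩ := hasValue_header_mod (x := x) (y := y) h0
  have := (hv.shr (hasValue_width h0)).lowBits (hasValue_width h0) width_lt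
  rwa [h1] at this

theorem hasValue_logBins (h0 : val 0 = Λ.header) : HV Expr.logBins Λ.k := by
  obtain ⟨v, hv, -, -, h1⟩ := hasValue_header_mod (x := x) (y := y) h0
  have hw := hasValue_width (x := x) (y := y) h0
  have h2 : w < 2 ^ w := Nat.lt_two_pow_self
  have := (hv.shr (hw.add hw (by have := Λ.four_mul_width_le; omega))).lowBits hw width_lt
  rwa [h1] at this

theorem hasValue_field (h0 : val 0 = Λ.header) {a : Expr} {f : ℕ} (ha : HV a f)
    (hf : f < 2 ^ (Λ.k + 7)) :
    HV (Expr.field a) (val (f / 8) / 2 ^ (f % 8 * Λ.width) % 2 ^ Λ.width) := by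
  rw [← Λ.field_memImage val hf]
  have hw := hasValue_width (x := x) (y := y) h0
  have hl := hasValue_logPerWord (x := x) (y := y) h0
  have h2 : w < 2 ^ w := Nat.lt_two_pow_self
  have h3 : 2 ^ Λ.g ≤ w := le_trans (Nat.le_mul_of_pos_right _ Λ.width_pos) Λ.fit
  have h4 : Λ.g < 2 ^ Λ.g := Nat.lt_two_pow_self
  have h5 : f % 2 ^ Λ.g * Λ.width ≤ 2 ^ Λ.g * Λ.width :=
    Nat.mul_le_mul_right _ (Nat.mod_lt _ (by positivity)).le
  have h6 : f % 2 ^ Λ.g * Λ.width < 2 ^ w := (h5.trans Λ.fit).trans_lt h2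
  exact ((ha.shr hl).load.shr ((ha.lowBits hl (by omega)).mul hw h6)).lowBits hw width_lt

theorem hasValue_slotPrefix (h0 : val 0 = Λ.header) {a : Expr} {i : ℕ} (ha : HV a i)
    (hi : i < 2 ^ (Λ.k + 4)) (hv : val i < 2 ^ w) (r : ℕ) (hr : r ≤ 8) :
    HV (Expr.slotPrefix a r) (val i % 2 ^ (r * Λ.width)) := by
  have h2 : w < 2 ^ w := Nat.lt_two_pow_self
  have h3 := Λ.four_mul_width_le
  have h4 := Λ.width_pos
  have h5 : 2 ^ (Λ.k + 7) = 8 * 2 ^ (Λ.k + 4) := by ring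
  have h6 : 2 ^ (Λ.k + 7) ≤ 2 ^ w := Nat.pow_le_pow_right (by omega) Λ.k_add_le
  have h7 : 2 ^ 7 ≤ 2 ^ (Λ.k + 7) := Nat.pow_le_pow_right (by omega) (by omega)
  -- The shift distance may exceed w, being up to 7 · width ≤ 7w / 4, but it must itself be
  -- representable as a word.
  have h8 : w + w ≤ 2 ^ w := by
    obtain ⟨w', rfl⟩ : ∃ w', w = w' + 1 := ⟨w - 1, by omega⟩
    have : w' < 2 ^ w' := Nat.lt_two_pow_self
    rw [pow_succ]
    omega
  induction r with
  | zero =>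
    rw [zero_mul, pow_zero, Nat.mod_one]
    exact Expr.hasValue_const (by positivity)
  | succ r ih =>
    have h9 : val i % 2 ^ ((r + 1) * Λ.width) =
        val i % 2 ^ (r * Λ.width) +
          val i / 2 ^ (r * Λ.width) % 2 ^ Λ.width * 2 ^ (r * Λ.width) := by
      rw [add_mul, one_mul, pow_add, Nat.mod_mul, mul_comm (2 ^ (r * Λ.width))]
    have h10 : val i % 2 ^ ((r + 1) * Λ.width) < 2 ^ w := (Nat.mod_le _ _).trans_lt hv
    have h11 : r * Λ.width ≤ 7 * Λ.width := Nat.mul_le_mul_right _ (by omega)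
    have hf := hasValue_field (x := x) (y := y) h0
      (((Expr.hasValue_const (u := 8) (by omega)).mul ha (by omega)).add
        (Expr.hasValue_const (u := r) (by omega)) (by omega)) (by omega)
    rw [show (8 * i + r) / 8 = i by omega, show (8 * i + r) % 8 = r by omega] at hf
    rw [h9] at h10 ⊢
    exact (ih (by omega)).add (hf.shl ((Expr.hasValue_const (u := r) (by omega)).mul
      (hasValue_width h0) (by omega)) (by omega)) h10

theorem hasValue_slot (h0 : val 0 = Λ.header) {a : Expr} {i : ℕ} (ha : HV a i)
    (hi : i < 2 ^ (Λ.k + 4)) (hv : val i < 2 ^ w) (hv' : val i < 2 ^ (8 * Λ.width)) :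
    HV (Expr.slot a) (val i) := by
  have := hasValue_slotPrefix h0 ha hi hv 8 le_rfl
  rwa [Nat.mod_eq_of_lt hv'] at this

/-- Evaluation of the size and the index of the class of the element at position `p` of bin `j`,
which lies in piece `δ` of the bin at position `q`. -/
theorem hasValue_class (h0 : val 0 = Λ.header) {z : Expr} {j p t δ q s F M h e N : ℕ}
    (hz : HV z (p * 2 ^ Λ.k + j + 1)) (hj : j < 2 ^ Λ.k)
    (hNw : N ≤ 2 ^ w) (hN : N ≤ 2 ^ (8 * Λ.width))
    (ht : val (16 * j + 1) = t) (htN : t < N)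
    (hδ : (p < t ∧ δ = 0 ∧ q = p) ∨ (t ≤ p ∧ δ = 1 ∧ q = p - t))
    (hs : val (16 * j + (8 * δ + 2)) = s) (hsN : s < N)
    (hF : val (16 * j + (8 * δ + 3)) = F) (hFN : F < N)
    (hM : val (16 * j + (8 * δ + 4)) = M) (hMN : M < N)
    (hh : val (16 * j + (8 * δ + 5)) = h) (hhN : h < N)
    (he : val (16 * j + (8 * δ + 6)) = e) (heN : e < N)
    (hqF : q + F < 2 ^ w) (hqM : (q + F) * M < 2 ^ w) (hres : (q + F) * M / 2 ^ h + e < 2 ^ w) :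
    HV (Expr.classSize z) s ∧ HV (Expr.classIndex z) ((q + F) * M / 2 ^ h + e) := by
  have hkw := Λ.k_add_le
  have hk : 2 ^ (Λ.k + 4) = 16 * 2 ^ Λ.k := by ring
  have hkw' : 2 ^ (Λ.k + 4) ≤ 2 ^ w := Nat.pow_le_pow_right (by omega) (by omega)
  have hk0 : 0 < 2 ^ Λ.k := by positivity
  have hw7 : 2 ^ 7 ≤ 2 ^ w := Nat.pow_le_pow_right (by omega) (by omega)
  have h1 : HV (.const 1) 1 := Expr.hasValue_const (by omega)
  have hz1 := hz.sub h1 (by omega)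
  rw [Nat.add_sub_cancel] at hz1
  have hp := hz1.shr (hasValue_logBins h0)
  rw [show (p * 2 ^ Λ.k + j) / 2 ^ Λ.k = p by
    rw [add_comm, Nat.add_mul_div_right _ _ hk0, Nat.div_eq_of_lt hj, zero_add]] at hp
  have hb := hz1.lowBits (hasValue_logBins h0) (by omega)
  rw [show (p * 2 ^ Λ.k + j) % 2 ^ Λ.k = j by
    rw [add_comm, Nat.add_mul_mod_self_right, Nat.mod_eq_of_lt hj]] at hb
  -- Each bin owns 16 slots: slot 1 for the threshold and slots 8δ + 2, …, 8δ + 6 for piece δ. Slot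
  -- 0 of bin 0 is free for the header.
  replace hb : HV (Expr.binSlot z) (16 * j) :=
    (Expr.hasValue_const (u := 16) (by omega)).mul hb (by omega)
  replace hp : HV (Expr.binPos z) p := hp
  have slotv : ∀ {a : Expr} {i v : ℕ}, HV a (16 * j + i) → i < 16 → val (16 * j + i) = v →
      v < N → HV (Expr.slot a) v := by
    intro a i v ha hi hv hvN
    subst hv
    exact hasValue_slot h0 ha (by omega) (by omega) (by omega)
  have hthr : HV (Expr.threshold z) t := slotv (hb.add h1 (by omega)) (by omega) ht htN
  have hpiece : HV (Expr.piece z) δ := by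
    have := h1.sub (hp.lt hthr (by omega)) (by split_ifs <;> omega)
    rcases hδ with ⟨h2, rfl, -⟩ | ⟨h2, rfl, -⟩
    · rwa [if_pos h2] at this
    · rwa [if_neg (by omega)] at this
  have hδ1 : δ ≤ 1 := by omega
  have hq : HV (Expr.piecePos z) q := by
    rcases hδ with ⟨h2, rfl, rfl⟩ | ⟨h2, rfl, rfl⟩
    · have := hp.sub (hpiece.mul hthr (by omega)) (by omega)
      rwa [zero_mul, Nat.sub_zero] at this
    · have := hp.sub (hpiece.mul hthr (by omega)) (by omega)
      rwa [one_mul] at this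
  have entry : ∀ {i v : ℕ}, i < 8 → val (16 * j + (8 * δ + i)) = v → v < N →
      HV (Expr.pieceEntry z i) v := fun hi hv hvN =>
    slotv (hb.add (((Expr.hasValue_const (u := 8) (by omega)).mul hpiece (by omega)).add
      (Expr.hasValue_const (by omega)) (by omega)) (by omega)) (by omega) hv hvN
  refine ⟨entry (by omega) hs hsN, ?_⟩
  exact ((((hq.add (entry (by omega) hF hFN) hqF).mul (entry (by omega) hM hMN) hqM).shr
    (entry (by omega) hh hhN)).add (entry (by omega) he heN) hres)

end Reading

end Layout

end WordRAM

/-! ### Choice of parameters, labels and memory contents -/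

namespace WordRAM

/-- The width is a power of two of order l, at least 8 so that g and k fit into a field, and at most
w / 4 so that four fields fit into a word; this is where 32 comes from. Capping g at k + 7 lets a
very long word hold all fields at once. -/
theorem Layout.exists_of_size {w l : ℕ} (hw : 32 ≤ w) (hl : 0 < l) (hlw : l ≤ w) :
    ∃ Λ : Layout w, Λ.k = l / 2 + 3 ∧ l ≤ 8 * Λ.width ∧ 8 ≤ Λ.width ∧ Λ.width ≤ 8 * l := by
  obtain ⟨b, h8, hlb, hbl, hbw⟩ :
      ∃ b, 8 ≤ 2 ^ b ∧ l ≤ 8 * 2 ^ b ∧ 2 ^ b ≤ 8 * l ∧ 4 * 2 ^ b ≤ w := by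
    by_cases h : l ≤ 64
    · exact ⟨3, by norm_num, by omega, by omega, by omega⟩
    · have h1 : 6 ≤ Nat.log 2 l := Nat.le_log_of_pow_le (by omega) (by omega)
      have h2 : 2 ^ Nat.log 2 l ≤ l := Nat.pow_log_le_self 2 (by omega)
      have h3 : l < 2 ^ (Nat.log 2 l + 1) := Nat.lt_pow_succ_log_self (by omega) l
      obtain ⟨c, hc⟩ : ∃ c, Nat.log 2 l = c + 2 := ⟨Nat.log 2 l - 2, by omega⟩
      rw [hc] at h1 h2 h3
      have h4 : 2 ^ 3 ≤ 2 ^ c := Nat.pow_le_pow_right (by omega) (by omega)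
      have h5 : 2 ^ (c + 2) = 4 * 2 ^ c := by ring
      have h6 : 2 ^ (c + 2 + 1) = 8 * 2 ^ c := by ring
      exact ⟨c, by omega, by omega, by omega, by omega⟩
  have hB : 0 < 2 ^ b := by positivity
  have hq : 4 ≤ w / 2 ^ b := (Nat.le_div_iff_mul_le hB).2 hbw
  have hlog : 2 ≤ Nat.log 2 (w / 2 ^ b) := Nat.le_log_of_pow_le (by omega) (by omega)
  have hpow : 8 * 2 ^ b + 2 ^ 5 ≤ 2 ^ 2 ^ b := by
    obtain ⟨c, hc⟩ : ∃ c, 2 ^ b = c + 8 := ⟨2 ^ b - 8, by omega⟩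
    rw [hc]
    have : c < 2 ^ c := Nat.lt_two_pow_self
    rw [pow_add]
    omega
  refine ⟨⟨b, min (l / 2 + 3 + 7) (Nat.log 2 (w / 2 ^ b)), l / 2 + 3, by omega, by omega, by omega,
    by omega, ?_, by omega, ?_⟩, rfl, hlb, h8, hbl⟩
  · refine (Nat.le_div_iff_mul_le hB).1 ?_
    exact (Nat.pow_le_pow_right (by omega) (by omega)).trans
      (Nat.pow_log_le_self 2 (show w / 2 ^ b ≠ 0 by omega))
  · by_cases h : l / 2 + 3 + 7 ≤ Nat.log 2 (w / 2 ^ b)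
    · exact Or.inl (by omega)
    · refine Or.inr ?_
      rw [min_eq_right (by omega)]
      exact ((Nat.div_lt_iff_lt_mul hB).1 (Nat.lt_pow_succ_log_self (by omega) _)).le

/-- The capacities of `K` bins into which `n` labels are distributed cyclically. -/
def binCapacity (n K j : ℕ) : ℕ := n / K + if j < n % K then 1 else 0

theorem sum_binCapacity (n : ℕ) {K : ℕ} (hK : 0 < K) :
    ∑ j ∈ Finset.range K, binCapacity n K j = n := by
  have h1 : (Finset.range K).filter (· < n % K) = Finset.range (n % K) := by
    ext j
    have := Nat.mod_lt n hK
    simp only [Finset.mem_filter, Finset.mem_range]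
    omega
  simp only [binCapacity, Finset.sum_add_distrib, Finset.sum_const, Finset.card_range,
    smul_eq_mul, Finset.sum_boole, h1, Nat.cast_id]
  exact Nat.div_add_mod n K

theorem lt_of_lt_binCapacity {n K j p : ℕ} (hj : j < K) (hp : p < binCapacity n K j) :
    p * K + j < n := by
  have hd := Nat.div_add_mod' n K
  unfold binCapacity at hp
  split_ifs at hp with h
  · have : p * K ≤ n / K * K := Nat.mul_le_mul_right _ (by omega)
    omega
  · have : (p + 1) * K ≤ n / K * K := Nat.mul_le_mul_right _ (by omega)
    rw [add_mul] at this
    omega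

/-- Labels and memory contents for a given partition. -/
theorem Layout.exists_labelling {w l : ℕ} (Λ : Layout w) (hw : 32 ≤ w) (hlw : l ≤ w)
    (hl8 : l ≤ 8 * Λ.width) (h8 : 8 ≤ Λ.width) (hk : Λ.k = l / 2 + 3)
    {α : Type*} [Fintype α] (r : Setoid α) (hn : Fintype.card α < 2 ^ l) :
    ∃ (label : α → ℕ) (val : ℕ → ℕ) (s c : α → ℕ), Function.Injective label ∧
      (∀ x, 1 ≤ label x ∧ label x ≤ Fintype.card α) ∧
      (∀ x y, r x y ↔ s x = s y ∧ c x = c y) ∧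
      ∀ (a : α) (x y : BitVec w) (z : Expr),
        Expr.HasValue x y (memImage (Λ.data val) w) z (label a) →
          Expr.HasValue x y (memImage (Λ.data val) w) (Expr.classSize z) (s a) ∧
          Expr.HasValue x y (memImage (Λ.data val) w) (Expr.classIndex z) (c a) := by
  classical
  obtain ⟨T, g, s, u, hgsum, hT, hsT, hinj, hrel⟩ := exists_class_coordinates r
  set n := Fintype.card α with hn_def
  set K := 2 ^ Λ.k with hKdef
  have hK : 0 < K := by positivity
  have hgn : ∀ i ∈ T, g i ≤ n := fun i hi => by
    rw [← hgsum]
    exact Finset.single_le_sum (fun _ _ => Nat.zero_le _) hi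
  -- From k = l / 2 + 3 follows 2k ≥ l + 3, and n < 2^l.
  have hKK : 8 * n ≤ K * K := by
    have : 2 ^ (l + 3) ≤ K * K := by
      rw [hKdef, ← pow_add]
      exact Nat.pow_le_pow_right (by omega) (by omega)
    rw [pow_add] at this
    omega
  have hTK : T.card ≤ K :=
    card_le_of_sum_le (fun i hi => (hT i hi).1)
      (hgsum ▸ Finset.sum_le_sum fun i hi => (hT i hi).2) hKK
  -- The alias method needs as many items as bins; the missing ones get weight zero.
  obtain ⟨S, hTS, hSK⟩ := Infinite.exists_superset_card_eq T K hTK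
  set g₀ : ℕ → ℕ := fun i => if i ∈ T then g i else 0 with hg₀
  have hsum : ∑ i ∈ S, g₀ i = ∑ j ∈ Finset.range K, binCapacity n K j := by
    rw [sum_binCapacity n hK, ← hgsum, ← Finset.sum_subset hTS]
    · exact Finset.sum_congr rfl fun i hi => by simp [hg₀, hi]
    · intro i _ hi
      simp [hg₀, hi]
  obtain ⟨t, a, b, o, htc, H⟩ := exists_alias_distribution (n / K) (binCapacity n K)
    (Finset.range K) S g₀ (by rw [hSK, Finset.card_range]) hsum
    (fun j _ => by unfold binCapacity; split_ifs <;> omega)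
  have H' : ∀ x : α, ∃ j < K, ∃ p < binCapacity n K j,
      (p < t j ∧ a j = s x ∧ p = u x) ∨ (t j ≤ p ∧ b j = s x ∧ o j + (p - t j) = u x) := by
    intro x
    obtain ⟨j, hj, h⟩ := H (s x) (hTS (hsT x).1) (u x) (by simp [hg₀, hsT x])
    exact ⟨j, Finset.mem_range.1 hj, h⟩
  choose jf hjf pf hpf hpos using H'
  have hlt : ∀ x, pf x * K + jf x < n := fun x => lt_of_lt_binCapacity (hjf x) (hpf x)
  set m := l - Λ.k with hm
  have hpm : ∀ x, pf x < 2 ^ m := by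
    intro x
    have h1 : 2 ^ l ≤ 2 ^ m * K := by
      rw [hKdef, ← pow_add]
      exact Nat.pow_le_pow_right (by omega) (by omega)
    have := hlt x
    exact Nat.lt_of_mul_lt_mul_right (a := K) (by omega)
  -- Padding items may have size 0, so the choice is made total and positivity is demanded only in
  -- its properties.
  have hrec : ∀ σ ω : ℕ, ∃ F M h e : ℕ, 0 < σ →
      F ≤ 2 ^ m ∧ M < 2 ^ (2 * m + 4) ∧ h < 2 ^ (2 * m + 4) ∧ e ≤ ω ∧
      ∀ p < 2 ^ m, (p + F) * M < 2 ^ (2 * m + 4) ∧ (p + F) * M / 2 ^ h + e = (ω + p) / σ := by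
    intro σ ω
    rcases Nat.eq_zero_or_pos σ with h | h
    · exact ⟨0, 0, 0, 0, fun h' => by omega⟩
    · obtain ⟨F, M, h', e, hyp⟩ := exists_reciprocal m σ ω h
      exact ⟨F, M, h', e, fun _ => hyp⟩
  choose F M h e hFMhe using hrec
  let entry : ℕ → ℕ → ℕ → ℕ → ℕ := fun θ σ ω i =>
    if i = 1 then θ else if i = 2 then σ else if i = 3 then F σ ω else if i = 4 then M σ ω
    else if i = 5 then h σ ω else e σ ω
  let val : ℕ → ℕ := fun i => if i = 0 then Λ.header else
    if i % 16 < 8 then entry (t (i / 16)) (a (i / 16)) 0 (i % 8)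
    else entry (t (i / 16)) (b (i / 16)) (o (i / 16)) (i % 8)
  have hval0 : ∀ j i, i < 8 → 0 < i → val (16 * j + i) = entry (t j) (a j) 0 i := by
    intro j i hi hi0
    simp only [val]
    rw [if_neg (by omega), if_pos (by omega), show (16 * j + i) / 16 = j by omega,
      show (16 * j + i) % 8 = i by omega]
  have hval1 : ∀ j i, i < 8 → val (16 * j + (8 + i)) = entry (t j) (b j) (o j) i := by
    intro j i hi
    simp only [val]
    rw [if_neg (by omega), if_neg (by omega), show (16 * j + (8 + i)) / 16 = j by omega,
      show (16 * j + (8 + i)) % 8 = i by omega]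
  -- A stored number must fit both into a word and into eight fields. The bound 2m + 4 ≤ W holds
  -- because m = l - k gives 2m + 4 ≤ l, or else m = 0 and W ≥ 32.
  set W := min w (8 * Λ.width) with hW
  have hN1 : 2 ^ W ≤ 2 ^ w := Nat.pow_le_pow_right (by omega) (by omega)
  have hN2 : 2 ^ W ≤ 2 ^ (8 * Λ.width) := Nat.pow_le_pow_right (by omega) (by omega)
  have hN3 : 2 ^ (2 * m + 4) ≤ 2 ^ W := Nat.pow_le_pow_right (by omega) (by omega)
  have hN4 : 2 ^ l ≤ 2 ^ W := Nat.pow_le_pow_right (by omega) (by omega)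
  have hN5 : 2 ^ m + 2 ^ m ≤ 2 ^ (2 * m + 4) := by
    rw [← two_mul, ← pow_succ']
    exact Nat.pow_le_pow_right (by omega) (by omega)
  have hm0 : 0 < 2 ^ m := by positivity
  have htn : ∀ x, t (jf x) ≤ n := by
    intro x
    have h1 := htc _ (Finset.mem_range.2 (hjf x))
    have h2 := hpf x
    have h3 := lt_of_lt_binCapacity (n := n) (K := K) (p := binCapacity n K (jf x) - 1) (hjf x) (by omega)
    have h4 : binCapacity n K (jf x) - 1 ≤ (binCapacity n K (jf x) - 1) * K :=
      Nat.le_mul_of_pos_right _ hK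
    omega
  refine ⟨fun x => pf x * K + jf x + 1, val, s, fun x => u x / s x, ?_,
    fun x => ⟨by simp, hlt x⟩, hrel, ?_⟩
  · intro x y hxy
    have hxy' : pf x * K + jf x = pf y * K + jf y := by simpa using hxy
    have hj : jf x = jf y := by
      have := congrArg (· % K) hxy'
      simpa [Nat.mul_add_mod', Nat.mod_eq_of_lt (hjf _)] using this
    have hp : pf x = pf y := by
      rw [hj] at hxy'
      exact Nat.eq_of_mul_eq_mul_right hK (by omega)
    have hx := hpos x
    have hy := hpos y
    -- Bin and position decide which alternative holds, and either one determines size and index.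
    rw [hj, hp] at hx
    refine hinj x y ?_ ?_ <;> omega
  · intro x X Y z hz
    have hsx := hsT x
    have hs0 := (hT _ hsx.1).1
    have hsg := (hT _ hsx.1).2
    have hgx := hgn _ hsx.1
    have hux : u x / s x ≤ u x := Nat.div_le_self _ _
    have ht := htn x
    have hp := hpm x
    rcases hpos x with ⟨h1, h2, h3⟩ | ⟨h1, h2, h3⟩
    · obtain ⟨r1, r2, r3, r4, r5⟩ := hFMhe (s x) 0 hs0
      obtain ⟨r6, r7⟩ := r5 (pf x) hp
      have hu : u x / s x = (pf x + F (s x) 0) * M (s x) 0 / 2 ^ h (s x) 0 + e (s x) 0 := by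
        rw [r7, zero_add, h3]
      dsimp only
      rw [hu]
      refine Λ.hasValue_class (val := val) (δ := 0) (N := 2 ^ W) rfl hz (hjf x) hN1 hN2
        (hval0 _ 1 (by omega) (by omega)) (by simp only [entry, if_true]; omega)
        (Or.inl ⟨by simpa [entry] using h1, rfl, rfl⟩)
        ((hval0 _ 2 (by omega) (by omega)).trans (by simp [entry, h2])) (by omega)
        ((hval0 _ 3 (by omega) (by omega)).trans (by simp [entry, h2])) (by omega)
        ((hval0 _ 4 (by omega) (by omega)).trans (by simp [entry, h2])) (by omega)
        ((hval0 _ 5 (by omega) (by omega)).trans (by simp [entry, h2])) (by omega)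
        ((hval0 _ 6 (by omega) (by omega)).trans (by simp [entry, h2])) (by omega)
        (by omega) (by omega) (by omega)
    · obtain ⟨r1, r2, r3, r4, r5⟩ := hFMhe (s x) (o (jf x)) hs0
      obtain ⟨r6, r7⟩ := r5 (pf x - t (jf x)) (by omega)
      dsimp only
      rw [← h3] at hux ⊢
      rw [← r7] at hux ⊢
      refine Λ.hasValue_class (val := val) (δ := 1) (N := 2 ^ W) rfl hz (hjf x) hN1 hN2
        (hval0 _ 1 (by omega) (by omega)) (by simp only [entry, if_true]; omega)
        (Or.inr ⟨by simpa [entry] using h1, rfl, by simp [entry]⟩)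
        ((hval1 _ 2 (by omega)).trans (by simp [entry, h2])) (by omega)
        ((hval1 _ 3 (by omega)).trans (by simp [entry, h2])) (by omega)
        ((hval1 _ 4 (by omega)).trans (by simp [entry, h2])) (by omega)
        ((hval1 _ 5 (by omega)).trans (by simp [entry, h2])) (by omega)
        ((hval1 _ 6 (by omega)).trans (by simp [entry, h2])) (by omega)
        (by omega) (by omega) (by omega)

end WordRAM

/-! ### Query program, short words and the space bound -/

namespace WordRAM

namespace Expr

theorem answersEquivQueries_program (e : Expr) {w L : ℕ} (hw : 0 < w) (d : BitVec L) {α : Type*}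
    (r : Setoid α) [DecidableRel r] (label : α → ℕ)
    (h : ∀ a b : α, HasValue (BitVec.ofNat w (label a)) (BitVec.ofNat w (label b))
      (memImage d w) e (if r a b then 1 else 0)) :
    AnswersEquivQueries e.program e.program.length w d r label := by
  have h1 : 1 < 2 ^ w := Nat.one_lt_two_pow hw.ne'
  intro a b
  have hab := h a b
  constructor
  · intro hr
    rw [if_pos hr] at hab
    convert e.returnsWithin_program d (BitVec.ofNat w (label a)) (BitVec.ofNat w (label b))
    rw [← BitVec.toNat_inj, hab]
    simp [Nat.mod_eq_of_lt h1]
  · intro hr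
    rw [if_neg hr] at hab
    convert e.returnsWithin_program d (BitVec.ofNat w (label a)) (BitVec.ofNat w (label b))
    rw [← BitVec.toNat_inj, hab]
    simp

section

variable {w : ℕ} {x y : BitVec w} {mem : BitVec w → BitVec w}

/-- The constant 2^31 is truncated to 0 exactly when w ≤ 31, so the program can detect short words.
-/
theorem hasValue_wordTest (hw : 0 < w) :
    HasValue x y mem (.eq (.const (2 ^ 31)) (.const 0)) (if w ≤ 31 then 1 else 0) := by
  by_cases h : w ≤ 31
  · have h0 : HasValue x y mem (.const (2 ^ 31)) 0 := by
      unfold HasValue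
      rw [eval, BitVec.toNat_ofNat]
      exact Nat.mod_eq_zero_of_dvd (pow_dvd_pow 2 h)
    rw [if_pos h]
    exact h0.eq (hasValue_const (by positivity)) hw
  · rw [if_neg h]
    exact (hasValue_const (Nat.pow_lt_pow_right (by omega) (by omega))).eq
      (hasValue_const (by positivity)) hw

/-- The large-word answer is masked by 0, so whatever `equivLarge` computes from a table is
harmless. -/
theorem hasValue_equivQuery_of_le (hw : 0 < w) (h : w ≤ 31) :
    HasValue x y mem equivQuery (if mem x = mem y then 1 else 0) := by
  have h1 := hasValue_wordTest (x := x) (y := y) (mem := mem) hw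
  rw [if_pos h] at h1
  have h2 : HasValue x y mem (.eq (.load .x) (.load .y)) (if mem x = mem y then 1 else 0) := by
    have := HasValue.eq (x := x) (y := y) (mem := mem) (a := .load .x) (b := .load .y) rfl rfl hw
    simpa only [eval, BitVec.toNat_inj] using this
  have h3 := (h1.and h2).or
    (((hasValue_const (Nat.one_lt_two_pow hw.ne')).sub h1 le_rfl).and (b := equivLarge) rfl)
  rw [Nat.sub_self, Nat.zero_and, Nat.or_zero, Nat.and_comm, Nat.and_one_is_mod,
    Nat.mod_eq_of_lt (by split_ifs <;> omega)] at h3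
  exact h3

theorem hasValue_equivQuery_of_lt {p : Prop} [Decidable p] (h : 31 < w)
    (hp : HasValue x y mem equivLarge (if p then 1 else 0)) :
    HasValue x y mem equivQuery (if p then 1 else 0) := by
  have hw : 0 < w := by omega
  have h1 := hasValue_wordTest (x := x) (y := y) (mem := mem) hw
  rw [if_neg (by omega)] at h1
  have h3 := (h1.and (b := .eq (.load .x) (.load .y)) rfl).or
    (((hasValue_const (Nat.one_lt_two_pow hw.ne')).sub h1 (by omega)).and hp)
  rw [Nat.zero_and, Nat.zero_or, Nat.sub_zero, Nat.and_comm, Nat.and_one_is_mod,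
    Nat.mod_eq_of_lt (by split_ifs <;> omega)] at h3
  exact h3

theorem hasValue_equivLarge {s s' c c' : ℕ} (hw : 0 < w)
    (hs : HasValue x y mem (classSize .x) s) (hs' : HasValue x y mem (classSize .y) s')
    (hc : HasValue x y mem (classIndex .x) c) (hc' : HasValue x y mem (classIndex .y) c') :
    HasValue x y mem equivLarge (if x = y ∨ s = s' ∧ c = c' then 1 else 0) := by
  have h1 : HasValue x y mem (.eq .x .y) (if x = y then 1 else 0) := by
    have := HasValue.eq (x := x) (y := y) (mem := mem) (a := .x) (b := .y) rfl rfl hw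
    simpa only [eval, BitVec.toNat_inj] using this
  convert h1.or ((hs.eq hs' hw).and (hc.eq hc' hw)) using 1
  · rfl
  by_cases e1 : x = y <;> by_cases e2 : s = s' <;> by_cases e3 : c = c' <;> simp [e1, e2, e3]

/-- Equal labels are recognized as equivalent, whatever the memory. -/
theorem hasValue_equivQuery_self (hw : 0 < w) : HasValue x x mem equivQuery 1 := by
  by_cases h : w ≤ 31
  · simpa using hasValue_equivQuery_of_le (x := x) (y := x) (mem := mem) hw h
  · have := hasValue_equivQuery_of_lt (by omega)
      (hasValue_equivLarge (x := x) (y := x) (mem := mem) hw rfl rfl rfl rfl)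
    simpa using this

end

end Expr

/-- The bit string consisting of the words `f 0, …, f (N - 1)`. -/
def tableData (w N : ℕ) (f : ℕ → ℕ) : BitVec (N * w) :=
  BitVec.ofNat _ (Nat.ofBits fun t : Fin (N * w) => (f (t / w)).testBit (t % w))

theorem memImage_tableData {w N a : ℕ} (f : ℕ → ℕ) (ha : a < N) (haw : a < 2 ^ w) :
    memImage (tableData w N f) w (BitVec.ofNat w a) = BitVec.ofNat w (f a) := by
  refine BitVec.eq_of_getLsbD_eq fun i hi => ?_
  have hL : a * w + i < N * w := by
    calc a * w + i < (a + 1) * w := by rw [add_mul]; omega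
      _ ≤ N * w := Nat.mul_le_mul_right _ ha
  have e1 : (a * w + i) / w = a := by
    rw [mul_comm, Nat.mul_add_div (by omega), Nat.div_eq_of_lt hi, add_zero]
  have e2 : (a * w + i) % w = i := by rw [mul_comm, Nat.mul_add_mod, Nat.mod_eq_of_lt hi]
  rw [memImage, BitVec.getLsbD_extractLsb', BitVec.toNat_ofNat, Nat.mod_eq_of_lt haw, tableData,
    BitVec.getLsbD_ofNat, Nat.testBit_ofBits_lt _ _ hL, BitVec.getLsbD_ofNat]
  simp only [e1, e2, hL, hi, decide_true, Bool.true_and]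

theorem bijOn_Icc_of_injective {α : Type*} [Fintype α] {label : α → ℕ}
    (hinj : Function.Injective label) (h : ∀ a, 1 ≤ label a ∧ label a ≤ Fintype.card α) :
    Set.BijOn label Set.univ (Set.Icc 1 (Fintype.card α)) := by
  classical
  have himg : Finset.univ.image label = Finset.Icc 1 (Fintype.card α) := by
    refine Finset.eq_of_subset_of_card_le ?_ ?_
    · intro i hi
      obtain ⟨a, -, rfl⟩ := Finset.mem_image.1 hi
      exact Finset.mem_Icc.2 (h a)
    · rw [Finset.card_image_of_injective _ hinj, Nat.card_Icc, Finset.card_univ]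
      omega
  refine ⟨fun a _ => h a, hinj.injOn, ?_⟩
  intro i hi
  have : i ∈ Finset.univ.image label := by rw [himg]; exact Finset.mem_Icc.2 hi
  obtain ⟨a, -, rfl⟩ := Finset.mem_image.1 this
  exact ⟨a, trivial, rfl⟩

theorem exists_label {α : Type*} [Fintype α] : ∃ label : α → ℕ, Function.Injective label ∧
    ∀ a, 1 ≤ label a ∧ label a ≤ Fintype.card α :=
  ⟨fun a => Fintype.equivFin α a + 1,
    fun _ _ hab => (Fintype.equivFin α).injective (Fin.ext (Nat.succ_injective hab)),
    fun _ => ⟨Nat.le_add_left _ _, Fin.is_lt _⟩⟩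

theorem one_le_sqrt_mul_logb {n : ℕ} (hn : 2 ≤ n) :
    1 ≤ Real.sqrt n ∧ 1 ≤ Real.logb 2 n := by
  have h2 : (2 : ℝ) ≤ n := by exact_mod_cast hn
  constructor
  · rw [Real.one_le_sqrt]
    linarith
  · rw [Real.le_logb_iff_rpow_le (by norm_num) (by linarith)]
    simpa using h2

/-- With l the binary length of n ≥ 2, one has 2^(l / 2) ≤ 2√n and l ≤ 1 + lg n ≤ 2 lg n. -/
theorem length_le_sqrt_mul_logb {n B : ℕ} (hn : 2 ≤ n) (hB : B ≤ 8 * n.size) :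
    ((2 ^ (n.size / 2 + 3 + 8) * B : ℕ) : ℝ) ≤ 2 ^ 16 * (Real.sqrt n * Real.logb 2 n) := by
  obtain ⟨h1, h2⟩ := one_le_sqrt_mul_logb hn
  have hs : 0 < n.size := Nat.size_pos.2 (by omega)
  have hlow : 2 ^ (n.size - 1) ≤ n := Nat.lt_size.1 (by omega)
  have hn0 : (0 : ℝ) < n := by exact_mod_cast (by omega : 0 < n)
  have hl : (n.size : ℝ) ≤ 2 * Real.logb 2 n := by
    have : ((n.size - 1 : ℕ) : ℝ) ≤ Real.logb 2 n := by
      rw [Real.le_logb_iff_rpow_le (by norm_num) hn0, Real.rpow_natCast]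
      exact_mod_cast hlow
    rw [Nat.cast_sub hs] at this
    push_cast at this
    linarith
  have hp : (2 : ℝ) ^ (n.size / 2) ≤ 2 * Real.sqrt n := by
    have h3 : 2 ^ (n.size / 2) * 2 ^ (n.size / 2) ≤ 2 * n := by
      rw [← pow_add]
      calc 2 ^ (n.size / 2 + n.size / 2) ≤ 2 ^ (n.size - 1 + 1) :=
            Nat.pow_le_pow_right (by omega) (by omega)
        _ = 2 * 2 ^ (n.size - 1) := pow_succ' _ _
        _ ≤ 2 * n := by omega
    have h4 : (2 : ℝ) ^ (n.size / 2) * 2 ^ (n.size / 2) ≤ 2 * n := by exact_mod_cast h3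
    refine abs_le_of_sq_le_sq' ?_ (by positivity) |>.2
    rw [mul_pow, Real.sq_sqrt hn0.le]
    nlinarith
  have hB' : (B : ℝ) ≤ 8 * n.size := by exact_mod_cast hB
  push_cast
  calc (2 : ℝ) ^ (n.size / 2 + 3 + 8) * B = 2 ^ 11 * (2 ^ (n.size / 2) * B) := by ring
    _ ≤ 2 ^ 11 * ((2 * Real.sqrt n) * (16 * Real.logb 2 n)) := by
        gcongr
        linarith
    _ = 2 ^ 16 * (Real.sqrt n * Real.logb 2 n) := by ring

end WordRAM

open WordRAM in
theorem theorem5 :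
    ∃ (P : WordRAM.Program) (T : ℕ) (C : ℝ),
      ∀ (n w : ℕ), n < 2 ^ w →
        ∀ (α : Type*) [Fintype α], Fintype.card α = n →
          ∀ r : Setoid α,
            ∃ (label : α → ℕ) (L : ℕ) (d : BitVec L),
              Set.BijOn label Set.univ (Set.Icc 1 n) ∧
              (L : ℝ) ≤ C * (Real.sqrt n * Real.logb 2 n) ∧
              WordRAM.AnswersEquivQueries P T w d r label := by
  classical
  -- The constant 2^36 covers the table for short words, of at most 2^31 · 31 bits.
  refine ⟨Expr.equivQuery.program, Expr.equivQuery.program.length, 2 ^ 36, ?_⟩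
  rintro n w hn α _ rfl r
  rcases Nat.lt_or_ge (Fintype.card α) 2 with hcard | hcard
  -- Since lg 1 = 0, no bits at all are allowed for n = 1; the test `x = y` in the query still
  -- answers correctly.
  · have hsub : Subsingleton α := Fintype.card_le_one_iff_subsingleton.1 (by omega)
    obtain ⟨label, hinj, hlabel⟩ := exists_label (α := α)
    refine ⟨label, 0, 0, bijOn_Icc_of_injective hinj hlabel, ?_, ?_⟩
    · interval_cases Fintype.card α <;> simp
    · intro a b
      have hw : 0 < w := by
        have := hlabel a
        by_contra h
        obtain rfl : w = 0 := by omega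
        omega
      refine Expr.answersEquivQueries_program _ hw _ r label (fun a b => ?_) a b
      obtain rfl := Subsingleton.elim a b
      rw [if_pos (r.refl a)]
      exact Expr.hasValue_equivQuery_self hw
  obtain ⟨hsqrt, hlog⟩ := one_le_sqrt_mul_logb hcard
  have hone : 1 ≤ Real.sqrt (Fintype.card α) * Real.logb 2 (Fintype.card α) :=
    one_le_mul_of_one_le_of_one_le hsqrt hlog
  have hw : 0 < w := by
    by_contra h
    obtain rfl : w = 0 := by omega
    omega
  rcases Nat.lt_or_ge 31 w with hw32 | hw32
  · have hsize : 0 < (Fintype.card α).size := Nat.size_pos.2 (by omega)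
    obtain ⟨Λ, hk, hl8, h8, hB⟩ := Layout.exists_of_size (by omega) hsize (Nat.size_le.2 hn)
    obtain ⟨label, val, s, c, hinj, hlabel, hr, hval⟩ := Λ.exists_labelling (by omega)
      (Nat.size_le.2 hn) hl8 h8 hk r (Nat.lt_size_self _)
    refine ⟨label, _, Λ.data val, bijOn_Icc_of_injective hinj hlabel, ?_, ?_⟩
    · rw [hk]
      refine (length_le_sqrt_mul_logb hcard hB).trans ?_
      gcongr <;> norm_num
    · refine Expr.answersEquivQueries_program _ hw _ r label fun a b => ?_
      have hlt : ∀ a, label a < 2 ^ w := fun a => (hlabel a).2.trans_lt hn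
      have htoNat : ∀ a, (BitVec.ofNat w (label a)).toNat = label a := fun a => by
        rw [BitVec.toNat_ofNat, Nat.mod_eq_of_lt (hlt a)]
      obtain ⟨ha, ha'⟩ := hval a (BitVec.ofNat w (label a)) (BitVec.ofNat w (label b)) .x (htoNat a)
      obtain ⟨hb, hb'⟩ := hval b (BitVec.ofNat w (label a)) (BitVec.ofNat w (label b)) .y (htoNat b)
      convert Expr.hasValue_equivQuery_of_lt hw32 (Expr.hasValue_equivLarge hw ha hb ha' hb') using 3
      rw [← hr, or_iff_right_of_imp]
      intro h
      obtain rfl : a = b := hinj (by rw [← htoNat a, ← htoNat b, h])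
      exact r.refl a
  · obtain ⟨label, hinj, hlabel⟩ := exists_label (α := α)
    have hlt : ∀ a, label a < 2 ^ w := fun a => (hlabel a).2.trans_lt hn
    -- The table sends a label to the label of a fixed representative of its class. It has n + 1
    -- words because labels start at 1.
    obtain ⟨f, hf⟩ : ∃ f : ℕ → ℕ, ∀ a, f (label a) = label (Quotient.out (⟦a⟧ : Quotient r)) :=
      ⟨fun i => if h : ∃ a, label a = i then label (Quotient.out (⟦h.choose⟧ : Quotient r)) else 0,
        fun a => by
          have h : ∃ b, label b = label a := ⟨a, rfl⟩
          beta_reduce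
          rw [dif_pos h, hinj h.choose_spec]⟩
    refine ⟨label, _, tableData w (Fintype.card α + 1) f, bijOn_Icc_of_injective hinj hlabel,
      ?_, ?_⟩
    · have h1 : (Fintype.card α + 1) * w ≤ 2 ^ 36 := by
        calc (Fintype.card α + 1) * w ≤ 2 ^ 31 * 31 :=
              Nat.mul_le_mul (Nat.succ_le_iff.2 hn |>.trans
                (Nat.pow_le_pow_right (by omega) hw32)) hw32
          _ ≤ 2 ^ 36 := by norm_num
      have h2 : (((Fintype.card α + 1) * w : ℕ) : ℝ) ≤ 2 ^ 36 := by exact_mod_cast h1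
      linarith
    · refine Expr.answersEquivQueries_program _ hw _ r label fun a b => ?_
      convert Expr.hasValue_equivQuery_of_le hw hw32 using 2
      rw [memImage_tableData f (by have := (hlabel a).2; omega) (hlt a),
        memImage_tableData f (by have := (hlabel b).2; omega) (hlt b), hf, hf,
        ← BitVec.toNat_inj, BitVec.toNat_ofNat, BitVec.toNat_ofNat, Nat.mod_eq_of_lt (hlt _),
        Nat.mod_eq_of_lt (hlt _), hinj.eq_iff, Quotient.out_inj]
      exact Quotient.eq.symm
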